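/- **Notation.** For $0\le d\le n$ let $\mathrm{Gr}_{d,n}$ be the Grassmannian of $d$-dimensional subspaces of $\mathbb{R}^n$, with its usual topology (the quotient topology from real $d\times n$ matrices of rank $d$, via the row span). For $V\in\mathrm{Gr}_{d,n}$ represented by a $d\times n$ matrix $A$ (whose rows form a basis of $V$) and a $d$-subset $I$ of $[n]=\{1,\dots,n\}$, the Plücker coordinate $\Delta_I(V)$ is the maximal minor of $A$ in the columns $I$; these are defined up to a common nonzero factor. $\mathrm{Gr}_{d,n}^{\ge0}$ is the set of $V$ whose Plücker coordinates can be chosen all nonnegative. For a subspace $W\subseteq\mathbb{R}^n$, $\mathrm{Gr}_m(W)\subseteq\mathrm{Gr}_{m,n}$ is the subspace of those $X$ with $X\subseteq W$. For a finite real sequence $v\ne0$, $\mathrm{var}(v)$ is the number of sign changes of $v$, zeros being ignored, and $\mathrm{var}(0)=-1$. *Extension problem for $(l,k',n)$, where $l\le k'\le n$:* is every $V\in\mathrm{Gr}_{l,n}$ with $\mathrm{var}(v)\le k'-1$ for all $v\in V$ contained in an element of $\mathrm{Gr}_{k',n}^{\ge0}$? **Proposition.** Let $k,m\ge0$ and $n\ge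 k+m$, let $Z$ be a real $(k+m)\times n$ matrix whose maximal minors are all positive, with columns $z_1,\dots,z_n\in\mathbb{R}^{k+m}$ and row span $W$. For every $V\in\mathrm{Gr}_{k,n}^{\ge0}$ one has $\dim(V^\perp\cap W)=m$ and $\dim Z(V)=k$; put $$\mathcal B_{n,k,m}(W)=\{V^\perp\cap W: V\in\mathrm{Gr}_{k,n}^{\ge0}\}\subseteq\mathrm{Gr}_m(W),\qquad \mathcal A_{n,k,m}(Z)=\{Z(V):V\in\mathrm{Gr}_{k,n}^{\ge0}\}\subseteq\mathrm{Gr}_{k,k+m},$$ $$\mathcal G=\{X\in\mathrm{Gr}_m(W):\mathrm{var}(v)\ge k\text{ for all }v\in X\setminus\{0\}\},\qquad \mathcal F=f_Z(\mathcal G),$$ where $f_Z:\mathrm{Gr}_m(W)\to\mathrm{Gr}_{k,k+m}$ is the map $f_Z(X)=Z(X^\perp)$. Closures are taken in $\mathrm{Gr}_m(W)$ and $\mathrm{Gr}_{k,k+m}$ respectively. 1. $\mathcal G$ is open in $\mathrm{Gr}_m(W)$ and $\mathcal B_{n,k,m}(W)\subseteq\overline{\mathcal G}$. If the extension problem has a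 positive answer for $(m,n-k,n)$ (in particular, if it always has a positive answer), then $\mathcal B_{n,k,m}(W)=\overline{\mathcal G}$. 2. Let $X\in\mathrm{Gr}_m(W)$. Then $X\in\mathcal G$ if and only if, for every $(m-1)$-subset $I$ of $[n]$ such that the sequence $(\Delta_{I\cup\{j\}}(X))_{j\in[n]\setminus I}$ is not identically zero, $$\mathrm{var}\big(((-1)^{|I\cap[j]|}\Delta_{I\cup\{j\}}(X))_{j\in[n]\setminus I}\big)\ge k.$$ 3. Let $Y\in\mathrm{Gr}_{k,k+m}$ with basis $y_1,\dots,y_k$. Then $Y\in\mathcal F$ if and only if, for every $(m-1)$-subset $I=\{i_1<\cdots<i_{m-1}\}$ of $[n]$ such that the sequence $(\det[y_1|\cdots|y_k|z_{i_1}|\cdots|z_{i_{m-1}}|z_j])_{j\in[n]\setminus I}$ is not identically zero, this sequence satisfies $$\mathrm{var}\big((\det[y_1|\cdots|y_k|z_{i_1}|\cdots|z_{i_{m-1}}|z_j])_{j\in[n]\setminus I}\big)\ge k.$$ 4. $\mathcal A_{n,k,m}(Z)\subseteq\overline{\mathcal F}$. If the extension problem has a positive answer for $(m,n-k,n)$,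 then $\mathcal A_{n,k,m}(Z)=\overline{\mathcal F}$. (If $m=0$ there are no $(m-1)$-subsets $I$, and the conditions in 2 and 3 hold vacuously.) -/

import Mathlib

namespace Amplituhedron

noncomputable section

/-- `ℝⁿ` with its standard inner product. -/
abbrev E (n : ℕ) : Type := EuclideanSpace ℝ (Fin n)

/-! ### Grassmannians -/

/-- The real Grassmannian `Gr_{d,n}` of `d`-dimensional subspaces of `ℝⁿ`. -/
@[ext]
structure Gr (d n : ℕ) : Type where
  carrier : Submodule ℝ (E n)
  finrank_eq : Module.finrank ℝ carrier = d

/-- The `i`-th row of a `d × n` matrix, as a vector of `ℝⁿ`. -/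
def rowVec {d n : ℕ} (A : Matrix (Fin d) (Fin n) ℝ) (i : Fin d) : E n :=
  WithLp.toLp 2 (A i)

/-- The row span of a `d × n` matrix. -/
def rowSpan {d n : ℕ} (A : Matrix (Fin d) (Fin n) ℝ) : Submodule ℝ (E n) :=
  Submodule.span ℝ (Set.range (rowVec A))

theorem finrank_rowSpan {d n : ℕ} {A : Matrix (Fin d) (Fin n) ℝ}
    (hA : LinearIndependent ℝ (rowVec A)) : Module.finrank ℝ (rowSpan A) = d := by
  have h := finrank_span_eq_card hA
  rwa [Fintype.card_fin] at h

/-- The map taking a `d × n` matrix of rank `d` to the point of `Gr_{d,n}` it represents. -/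
def Gr.ofMatrix {d n : ℕ}
    (A : {A : Matrix (Fin d) (Fin n) ℝ // LinearIndependent ℝ (rowVec A)}) : Gr d n :=
  ⟨rowSpan A.1, finrank_rowSpan A.2⟩

/-- `Gr_{d,n}` carries the quotient topology: it is the space of `d × n` matrices of rank `d`
modulo left multiplication by invertible `d × d` matrices. -/
instance {d n : ℕ} : TopologicalSpace (Gr d n) :=
  TopologicalSpace.coinduced Gr.ofMatrix inferInstance

/-- `Gr_d(W)`, the set of elements of `Gr_{d,n}` contained in `W`, with the subspace topology. -/
abbrev GrIn {n : ℕ} (d : ℕ) (W : Submodule ℝ (E n)) : Type :=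
  {X : Gr d n // X.carrier ≤ W}

/-- The maximal minor of a `d × n` matrix located in the column set `I`. When the rows of `A`
form a basis of `V`, these are the Plücker coordinates `Δ_I(V)`. -/
def minor {d n : ℕ} (A : Matrix (Fin d) (Fin n) ℝ) (I : Finset (Fin n)) (hI : I.card = d) : ℝ :=
  (A.submatrix id (I.orderEmbOfFin hI)).det

/-- The totally nonnegative Grassmannian `Gr_{d,n}^{≥ 0}`. Plücker coordinates being defined up to
a common nonzero factor, `V` is totally nonnegative when some representing matrix has all its
maximal minors nonnegative. -/
def GrNonneg (d n : ℕ) : Set (Gr d n) :=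
  {V | ∃ A : Matrix (Fin d) (Fin n) ℝ, rowSpan A = V.carrier ∧
    ∀ (I : Finset (Fin n)) (hI : I.card = d), 0 ≤ minor A I hI}

/-! ### Sign variation -/

open Classical in
/-- `var(v)`, the number of sign changes of a finite sequence `v`, zeros being ignored: the number
of pairs of positions at which `v` has opposite signs and between which it vanishes. By convention
`var(0) = -1`. -/
def signVar {ι : Type*} [Fintype ι] [LinearOrder ι] (v : ι → ℝ) : ℤ :=
  if v = 0 then -1 else
    ((Finset.univ.filter fun p : ι × ι =>
      p.1 < p.2 ∧ v p.1 * v p.2 < 0 ∧ ∀ l, p.1 < l → l < p.2 → v l = 0).card : ℤ)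

/-- The extension problem has a positive answer for `(l, k, n)`: every `l`-dimensional subspace `V`
of `ℝⁿ` with `var(v) ≤ k - 1` for all `v ∈ V` is contained in an element of `Gr_{k,n}^{≥ 0}`. -/
def ExtensionProperty (l k n : ℕ) : Prop :=
  ∀ V : Gr l n, (∀ v ∈ V.carrier, signVar v.ofLp ≤ (k : ℤ) - 1) →
    ∃ V' ∈ GrNonneg k n, V.carrier ≤ V'.carrier

/-! ### Amplituhedra -/

/-- The amplituhedron `𝒜_{n,k,m}(Z) = {Z(V) : V ∈ Gr_{k,n}^{≥ 0}}` in `Gr_{k,k+m}`. -/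
def ampA {n k m : ℕ} (Z : Matrix (Fin (k + m)) (Fin n) ℝ) : Set (Gr k (k + m)) :=
  {Y | ∃ V ∈ GrNonneg k n, Y.carrier = V.carrier.map Z.toEuclideanLin}

/-- The B-amplituhedron `ℬ_{n,k,m}(W) = {V^⊥ ∩ W : V ∈ Gr_{k,n}^{≥ 0}}` in `Gr_m(W)`. -/
def ampB {n : ℕ} (k m : ℕ) (W : Submodule ℝ (E n)) : Set (GrIn m W) :=
  {X | ∃ V ∈ GrNonneg k n, X.1.carrier = V.carrierᗮ ⊓ W}

/-- `𝒢 = {X ∈ Gr_m(W) : var(v) ≥ k for all v ∈ X ∖ {0}}`. -/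
def setG {n : ℕ} (k m : ℕ) (W : Submodule ℝ (E n)) : Set (GrIn m W) :=
  {X | ∀ v ∈ X.1.carrier, v ≠ 0 → (k : ℤ) ≤ signVar v.ofLp}

/-- A matrix with positive maximal minors has full rank. -/
theorem linearIndependent_of_minor_pos {d n : ℕ} (hdn : d ≤ n) {A : Matrix (Fin d) (Fin n) ℝ}
    (hA : ∀ (I : Finset (Fin n)) (hI : I.card = d), 0 < minor A I hI) :
    LinearIndependent ℝ (rowVec A) := by
  obtain ⟨I, -, hI⟩ := Finset.exists_subset_card_eq
    (s := (Finset.univ : Finset (Fin n))) (n := d) (by simpa using hdn)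
  have h1 : LinearIndependent ℝ (A.submatrix id (I.orderEmbOfFin hI)).row :=
    Matrix.linearIndependent_rows_iff_isUnit.2
      ((Matrix.isUnit_iff_isUnit_det _).2 (hA I hI).ne'.isUnit)
  let f : E n →ₗ[ℝ] (Fin d → ℝ) :=
    { toFun := fun v a => v (I.orderEmbOfFin hI a)
      map_add' := fun _ _ => rfl
      map_smul' := fun _ _ => rfl }
  exact LinearIndependent.of_comp f h1

theorem ker_toEuclideanLin {d n : ℕ} (A : Matrix (Fin d) (Fin n) ℝ) :
    LinearMap.ker A.toEuclideanLin = (rowSpan A)ᗮ := by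
  ext x
  rw [rowSpan, LinearMap.mem_ker, Submodule.mem_orthogonal']
  have key : ∀ i, inner ℝ x (rowVec A i) = A.toEuclideanLin x i := fun i => by
    simp [rowVec, PiLp.inner_apply, Matrix.toLpLin_apply, Matrix.mulVec, dotProduct]
  constructor
  · intro h u hu
    induction hu using Submodule.span_induction with
    | mem u hu => obtain ⟨i, rfl⟩ := hu; rw [key, h]; rfl
    | zero => simp
    | add u v _ _ hu hv => rw [inner_add_right, hu, hv, add_zero]
    | smul c u _ hu => rw [inner_smul_right, hu, mul_zero]
  · intro h
    ext i
    rw [← key i, h _ (Submodule.subset_span ⟨i, rfl⟩)]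
    rfl

theorem finrank_map_orthogonal {n k m : ℕ} {Z : Matrix (Fin (k + m)) (Fin n) ℝ}
    (hZ : LinearIndependent ℝ (rowVec Z)) (X : GrIn m (rowSpan Z)) :
    Module.finrank ℝ (X.1.carrierᗮ.map Z.toEuclideanLin) = k := by
  have hle : LinearMap.ker Z.toEuclideanLin ≤ X.1.carrierᗮ := by
    rw [ker_toEuclideanLin]
    exact Submodule.orthogonal_le X.2
  have h1 := LinearMap.finrank_range_add_finrank_ker (Z.toEuclideanLin.domRestrict X.1.carrierᗮ)
  rw [LinearMap.range_domRestrict, LinearMap.ker_domRestrict,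
    (Submodule.comapSubtypeEquivOfLe hle).finrank_eq, ker_toEuclideanLin] at h1
  have h2 := (rowSpan Z).finrank_add_finrank_orthogonal
  have h3 := X.1.carrier.finrank_add_finrank_orthogonal
  rw [finrank_rowSpan hZ] at h2
  rw [X.1.finrank_eq] at h3
  have h4 : Module.finrank ℝ (X.1.carrierᗮ.map Z.toEuclideanLin) +
      Module.finrank ℝ ↥(rowSpan Z)ᗮ = Module.finrank ℝ ↥X.1.carrierᗮ := h1
  omega

/-- The map `f_Z : Gr_m(W) → Gr_{k,k+m}`, `f_Z(X) = Z(X^⊥)`, where `Z` is a `(k+m) × n` matrix of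
full rank and `W` is its row span. -/
def fZ {n k m : ℕ} (Z : Matrix (Fin (k + m)) (Fin n) ℝ) (hZ : LinearIndependent ℝ (rowVec Z))
    (X : GrIn m (rowSpan Z)) : Gr k (k + m) :=
  ⟨X.1.carrierᗮ.map Z.toEuclideanLin, finrank_map_orthogonal hZ X⟩

/-! ### The two families of sequences -/

/-- For an `(m-1)`-subset `I` of `[n]`, the sequence `((-1)^{|I ∩ [j]|} Δ_{I ∪ {j}})_{j ∈ [n] ∖ I}`
of signed maximal minors of an `m × n` matrix `A`. -/
def pluckerSeq {n m : ℕ} (A : Matrix (Fin m) (Fin n) ℝ) (I : Finset (Fin n))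
    (hI : I.card + 1 = m) (j : {j : Fin n // j ∉ I}) : ℝ :=
  (-1) ^ (I.filter fun i => i ≤ j.1).card *
    minor A (insert j.1 I) ((Finset.card_insert_of_notMem j.2).trans hI)

/-- For an `(m-1)`-subset `I = {i₁ < ⋯ < i_{m-1}}` of `[n]`, the sequence
`(det [y₁ | ⋯ | y_k | z_{i₁} | ⋯ | z_{i_{m-1}} | z_j])_{j ∈ [n] ∖ I}`, where the `z_i` are the
columns of `Z`. -/
def detSeq {n k m : ℕ} (Z : Matrix (Fin (k + m)) (Fin n) ℝ) (y : Fin k → E (k + m))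
    (I : Finset (Fin n)) (hI : I.card + 1 = m) (j : {j : Fin n // j ∉ I}) : ℝ :=
  (Matrix.of fun r c : Fin (k + m) =>
    Fin.append (fun a : Fin k => y a r)
      (fun b : Fin m =>
        Z r ((Fin.snoc (I.orderEmbOfFin rfl) j.1 : Fin (I.card + 1) → Fin n)
          (Fin.cast hI.symm b))) c).det

end

end Amplituhedron

open Amplituhedron

namespace Amplituhedron

noncomputable section

/-! The engine is the Gantmakher–Krein theorem: vectors of a totally nonnegative `d`-dimensional
subspace have at most `d - 1` sign changes (`not_le_signVar_vecMul`), and nonzero vectors orthogonal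
to a totally positive one have at least `d` (`le_signVar_of_mem_orthogonal`). It rests on three
facts. A totally positive subspace has no nonzero vector alternating weakly on `d + 1` positions
(`not_weakly_alternating`). Taking the orthogonal complement and then applying alt : x ↦ ((-1)^j
x_j) turns maximal minors into complementary ones up to a common factor (`exists_dual`). A full-rank
matrix with nonnegative maximal minors is a limit of matrices with positive ones
(`exists_perturbation_minor_pos`).

For V totally nonnegative this gives V ∩ W^⊥ = 0, since `k - 1 < k + m`, hence both dimension
claims. The map f_Z is a homeomorphism with inverse Y ↦ Zᵀ(Y^⊥), and adjointness matches Z(V) with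
V^⊥ ∩ W, so results pass between 𝒜, ℱ and ℬ, 𝒢. Perturbing V to a totally positive V_t puts V_t^⊥ ∩
W in 𝒢, which gives the inclusions into closures. Conversely var(v) + var(alt v) ≤ n - 1 for v ≠ 0,
so X ∈ 𝒢 makes var at most n - k - 1 on alt X. This bound is a closed condition, so it survives in
the closure of 𝒢. If V' is a totally nonnegative extension of alt X of dimension n - k, then V =
alt(V'^⊥) is totally nonnegative and X = V^⊥ ∩ W by dimension.

For the two criteria, every nonzero vector of X dominates in sign pattern a vector of minimal
support, which up to scaling is the only vector of X vanishing on some m - 1 positions. Its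
coordinates are signed Plücker coordinates, or the determinants when X = Zᵀ(Y^⊥). Since replacing
entries by zero never creates sign changes, testing these vectors suffices. -/

theorem card_filter_lt_orderEmbOfFin {α : Type*} [LinearOrder α] {s : Finset α} {r : ℕ}
    (h : s.card = r) (i : Fin r) : (s.filter (· < s.orderEmbOfFin h i)).card = i := by
  have h1 : s.filter (· < s.orderEmbOfFin h i) =
      (Finset.Iio i).map (s.orderEmbOfFin h).toEmbedding := by
    ext q
    simp only [Finset.mem_filter, Finset.mem_map, Finset.mem_Iio]
    constructor
    · rintro ⟨hq, h2⟩
      have : q ∈ Set.range (s.orderEmbOfFin h) := by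
        rw [Finset.range_orderEmbOfFin]; exact hq
      obtain ⟨b, rfl⟩ := this
      exact ⟨b, (s.orderEmbOfFin h).lt_iff_lt.1 h2, rfl⟩
    · rintro ⟨b, hb, rfl⟩
      exact ⟨s.orderEmbOfFin_mem h b, (s.orderEmbOfFin h).lt_iff_lt.2 hb⟩
  rw [h1, Finset.card_map, Fin.card_Iio]

/-! ### Sign variation as strict alternation -/

section SignVariation

theorem eq_of_isPrev {ι : Type*} [LinearOrder ι] {v : ι → ℝ} {i q j : ι} (hi : v i ≠ 0) (hij : i < j)
    (hz : ∀ l, i < l → l < j → v l = 0) (hq : v q ≠ 0) (hqj : q < j)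
    (hz' : ∀ l, q < l → l < j → v l = 0) : q = i := by
  rcases lt_trichotomy q i with h | h | h
  · exact absurd (hz' i h hij) hi
  · exact h
  · exact absurd (hz q h hqj) hq

variable {ι : Type*} [Fintype ι] [LinearOrder ι]

open Classical in
/-- The positions at which the sign of `v` differs from that of the preceding nonzero entry. -/
def signChanges (v : ι → ℝ) : Finset ι :=
  Finset.univ.filter fun p => ∃ q, q < p ∧ v q * v p < 0 ∧ ∀ l, q < l → l < p → v l = 0

/-- The number of sign changes of `v` up to position `j`. -/
def changesUpTo (v : ι → ℝ) (j : ι) : ℕ := ((signChanges v).filter (· ≤ j)).card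

theorem mem_signChanges {v : ι → ℝ} {p : ι} : p ∈ signChanges v ↔
    ∃ q, q < p ∧ v q * v p < 0 ∧ ∀ l, q < l → l < p → v l = 0 := by
  simp [signChanges]

theorem ne_zero_of_mem_signChanges {v : ι → ℝ} {p : ι} (hp : p ∈ signChanges v) : v p ≠ 0 := by
  obtain ⟨q, -, h, -⟩ := mem_signChanges.1 hp
  rintro h0
  simp [h0] at h

theorem signVar_of_ne_zero {v : ι → ℝ} (hv : v ≠ 0) : signVar v = (signChanges v).card := by
  classical
  rw [signVar, if_neg hv, Nat.cast_inj]
  refine Finset.card_bij (fun p _ => p.2) ?_ ?_ ?_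
  · rintro ⟨q, p⟩ h
    exact mem_signChanges.2 ⟨q, (Finset.mem_filter.1 h).2⟩
  · rintro ⟨q, p⟩ h ⟨q', p'⟩ h' (rfl : p = p')
    obtain ⟨-, h1, h2, h3⟩ := Finset.mem_filter.1 h
    obtain ⟨-, h1', h2', h3'⟩ := Finset.mem_filter.1 h'
    have := eq_of_isPrev (v := v) (left_ne_zero_of_mul h2'.ne) h1' h3'
      (left_ne_zero_of_mul h2.ne) h1 h3
    exact Prod.ext this rfl
  · intro p hp
    obtain ⟨q, h⟩ := mem_signChanges.1 hp
    exact ⟨(q, p), Finset.mem_filter.2 ⟨Finset.mem_univ _, h⟩, rfl⟩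

theorem changesUpTo_mono (v : ι → ℝ) : Monotone (changesUpTo v) := fun _ _ h =>
  Finset.card_le_card fun _ hp => by
    simp only [Finset.mem_filter] at hp ⊢
    exact ⟨hp.1, hp.2.trans h⟩

theorem changesUpTo_le (v : ι → ℝ) (j : ι) : changesUpTo v j ≤ (signChanges v).card :=
  Finset.card_filter_le _ _

/-- Between consecutive nonzero positions the count of changes grows by one exactly when the sign
flips, so the factor `(-1) ^ changesUpTo` cancels every flip. -/
theorem mul_pos_of_consecutive {v : ι → ℝ} {i j : ι} (hij : i < j) (hi : v i ≠ 0) (hj : v j ≠ 0)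
    (hz : ∀ l, i < l → l < j → v l = 0) :
    0 < ((-1) ^ changesUpTo v i * v i) * ((-1) ^ changesUpTo v j * v j) := by
  classical
  have hmem : ∀ p ∈ signChanges v, p ≤ j → p ≤ i ∨ p = j := fun p hp hpj => by
    by_contra! h
    exact ne_zero_of_mem_signChanges hp (hz p h.1 (lt_of_le_of_ne hpj h.2))
  rcases lt_or_gt_of_ne (mul_ne_zero hi hj) with h | h
  · have hjm : j ∈ signChanges v := mem_signChanges.2 ⟨i, hij, h, hz⟩
    have : changesUpTo v j = changesUpTo v i + 1 := by
      rw [changesUpTo, changesUpTo, ← Finset.card_insert_of_notMem (a := j) (by simp [hij])]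
      congr 1
      ext p
      simp only [Finset.mem_filter, Finset.mem_insert]
      constructor
      · rintro ⟨h1, h2⟩
        rcases hmem p h1 h2 with h3 | h3
        exacts [Or.inr ⟨h1, h3⟩, Or.inl h3]
      · rintro (rfl | ⟨h1, h2⟩)
        exacts [⟨hjm, le_rfl⟩, ⟨h1, h2.trans hij.le⟩]
    rw [this]
    have h2 : ((-1 : ℝ) ^ changesUpTo v i) * ((-1) ^ changesUpTo v i) = 1 := by
      rw [← mul_pow]; simp
    calc (0 : ℝ) < -(v i * v j) := by linarith
      _ = -(((-1 : ℝ) ^ changesUpTo v i) * ((-1) ^ changesUpTo v i) * (v i * v j)) := by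
        rw [h2, one_mul]
      _ = _ := by ring
  · have : changesUpTo v j = changesUpTo v i := by
      rw [changesUpTo, changesUpTo]
      congr 1
      ext p
      simp only [Finset.mem_filter]
      refine ⟨fun ⟨h1, h2⟩ => ⟨h1, ?_⟩, fun ⟨h1, h2⟩ => ⟨h1, h2.trans hij.le⟩⟩
      refine (hmem p h1 h2).resolve_right ?_
      rintro rfl
      obtain ⟨q, hq1, hq2, hq3⟩ := mem_signChanges.1 h1
      rw [eq_of_isPrev hi hij hz (left_ne_zero_of_mul hq2.ne) hq1 hq3] at hq2
      exact lt_asymm h hq2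
    rw [this]
    have h2 : ((-1 : ℝ) ^ changesUpTo v i) * ((-1) ^ changesUpTo v i) = 1 := by
      rw [← mul_pow]; simp
    calc (0 : ℝ) < v i * v j := h
      _ = (((-1 : ℝ) ^ changesUpTo v i) * ((-1) ^ changesUpTo v i) * (v i * v j)) := by
        rw [h2, one_mul]
      _ = _ := by ring

/-- Chains the consecutive case by induction on `j`, through the last nonzero position strictly
between `i` and `j`. -/
theorem mul_pos_of_lt {v : ι → ℝ} {i j : ι} (hij : i < j) (hi : v i ≠ 0) (hj : v j ≠ 0) :
    0 < ((-1) ^ changesUpTo v i * v i) * ((-1) ^ changesUpTo v j * v j) := by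
  classical
  induction j using WellFoundedLT.induction with
  | ind j ih =>
  by_cases hz : ∀ l, i < l → l < j → v l = 0
  · exact mul_pos_of_consecutive hij hi hj hz
  push Not at hz
  obtain ⟨l, hl⟩ := (Finset.univ.filter fun l => i < l ∧ l < j ∧ v l ≠ 0).exists_maximal
    (by obtain ⟨l, h⟩ := hz; exact ⟨l, by simpa using h⟩)
  have hl1 := hl.1
  simp only [Finset.mem_filter, Finset.mem_univ, true_and] at hl1
  have h1 := ih l hl1.2.1 hl1.1 hl1.2.2
  have h2 := mul_pos_of_consecutive hl1.2.1 hl1.2.2 hj fun l' h h' => by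
    by_contra h0
    exact not_le_of_gt h (hl.2 (by simpa using ⟨hl1.1.trans h, h', h0⟩) h.le)
  set a := ((-1) ^ changesUpTo v i * v i)
  set b := ((-1) ^ changesUpTo v l * v l)
  set c := ((-1) ^ changesUpTo v j * v j)
  have h3 := mul_pos h1 h2
  have h4 : 0 ≤ b * b := mul_self_nonneg b
  by_contra h5
  push Not at h5
  nlinarith [mul_nonneg h4 (neg_nonneg.2 h5)]

/-- The sign of an entry is determined by the parity of the number of preceding changes. -/
theorem exists_sign (v : ι → ℝ) :
    ∃ ε : ℝ, ε ≠ 0 ∧ ∀ j, v j ≠ 0 → 0 < ε * ((-1) ^ changesUpTo v j * v j) := by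
  by_cases h : ∃ i, v i ≠ 0
  · obtain ⟨i, hi⟩ := h
    refine ⟨(-1) ^ changesUpTo v i * v i, mul_ne_zero (by simp) hi, fun j hj => ?_⟩
    rcases lt_trichotomy i j with h | rfl | h
    · exact mul_pos_of_lt h hi hj
    · exact mul_self_pos.2 (mul_ne_zero (by simp) hi)
    · rw [mul_comm]; exact mul_pos_of_lt h hj hi
  · push Not at h
    exact ⟨1, one_ne_zero, fun j hj => absurd (h j) hj⟩

/-- `v` has at least `k` sign changes iff it strictly alternates on some `k + 1` positions. -/
theorem le_signVar_iff {v : ι → ℝ} {k : ℕ} : (k : ℤ) ≤ signVar v ↔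
    ∃ f : Fin (k + 1) → ι, StrictMono f ∧
      ∃ ε : ℝ, ∀ i : Fin (k + 1), 0 < ε * ((-1) ^ (i : ℕ) * v (f i)) := by
  classical
  obtain ⟨ε, hε, hs⟩ := exists_sign v
  constructor
  · intro h
    have hv : v ≠ 0 := by
      rintro rfl
      simp [signVar] at h
      omega
    rw [signVar_of_ne_zero hv, Nat.cast_le] at h
    obtain ⟨j, hj⟩ := Function.ne_iff.1 hv
    obtain ⟨a, ha⟩ := (Finset.univ.filter fun l => v l ≠ 0).exists_minimal ⟨j, by simpa using hj⟩
    have ha0 : v a ≠ 0 := by simpa using ha.1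
    have hmin : ∀ l, v l ≠ 0 → a ≤ l := fun l hl => by
      by_contra h0
      exact h0 (ha.2 (by simpa using hl) (not_le.1 h0).le)
    have hap : a ∉ signChanges v := fun hp => by
      obtain ⟨q, h1, h2, -⟩ := mem_signChanges.1 hp
      exact not_le_of_gt h1 (hmin q (left_ne_zero_of_mul h2.ne))
    -- The first nonzero position together with all change positions: exactly `i` changes occur up
    -- to the `i`-th element of `Q`, so `exists_sign` becomes alternation along `Q`.
    set Q := insert a (signChanges v) with hQ
    have hQc : Q.card = (signChanges v).card + 1 := Finset.card_insert_of_notMem hap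
    have hQ0 : ∀ q ∈ Q, v q ≠ 0 := by
      intro q hq
      rcases Finset.mem_insert.1 hq with rfl | hq
      exacts [ha0, ne_zero_of_mem_signChanges hq]
    have hcnt : ∀ i, changesUpTo v (Q.orderEmbOfFin hQc i) = i := by
      intro i
      have hmem := Q.orderEmbOfFin_mem hQc i
      have h1 := card_filter_lt_orderEmbOfFin hQc i
      set q := Q.orderEmbOfFin hQc i
      have h2 : (insert q (Q.filter (· < q))).card =
          (insert a ((signChanges v).filter (· ≤ q))).card := by
        congr 1
        ext p
        have ha' := hmin q (hQ0 q hmem)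
        simp only [Finset.mem_insert, Finset.mem_filter, hQ, le_iff_lt_or_eq] at hmem ha' ⊢
        constructor
        · rintro (rfl | ⟨rfl | h3, h4⟩) <;> tauto
        · rintro (rfl | ⟨h3, h4 | rfl⟩)
          · rcases ha' with h | h
            exacts [Or.inr ⟨Or.inl rfl, h⟩, Or.inl h]
          · exact Or.inr ⟨Or.inr h3, h4⟩
          · exact Or.inl rfl
      rw [Finset.card_insert_of_notMem (by simp), Finset.card_insert_of_notMem (by simp [hap]),
        h1] at h2
      change _ = changesUpTo v q + 1 at h2
      omega
    have hle : k + 1 ≤ (signChanges v).card + 1 := by omega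
    refine ⟨fun i => Q.orderEmbOfFin hQc (Fin.castLE hle i),
      (Q.orderEmbOfFin hQc).strictMono.comp (Fin.strictMono_castLE hle), ε, fun i => ?_⟩
    have := hs _ (hQ0 _ (Q.orderEmbOfFin_mem hQc (Fin.castLE hle i)))
    rwa [hcnt] at this
  · rintro ⟨f, hf, δ, h⟩
    have h0 : ∀ i, v (f i) ≠ 0 := fun i => right_ne_zero_of_mul (right_ne_zero_of_mul (h i).ne')
    have hv : v ≠ 0 := fun h' => h0 0 (by rw [h']; rfl)
    rw [signVar_of_ne_zero hv, Nat.cast_le]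
    -- The count must increase strictly along `f`: if it stalled, the entries at two successive
    -- positions would have equal signs by `hs` and opposite signs by `h`.
    have key : ∀ i : ℕ, ∀ hi : i < k + 1, i ≤ changesUpTo v (f ⟨i, hi⟩) := by
      intro i
      induction i with
      | zero => intro _; exact Nat.zero_le _
      | succ i ih =>
        intro hi
        have hlt : f ⟨i, by omega⟩ < f ⟨i + 1, hi⟩ := hf (by simp)
        have h1 := ih (by omega)
        have h2 := changesUpTo_mono v hlt.le
        refine lt_of_le_of_ne (h1.trans h2) fun h3 => ?_
        have h4 : changesUpTo v (f ⟨i, by omega⟩) = changesUpTo v (f ⟨i + 1, hi⟩) := by omega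
        have h5 := hs _ (h0 ⟨i, by omega⟩)
        have h6 := hs _ (h0 ⟨i + 1, hi⟩)
        have h7 := h ⟨i, by omega⟩
        have h8 := h ⟨i + 1, hi⟩
        rw [← h4] at h6
        simp only [pow_succ] at h8
        have h9 := mul_pos (mul_pos h5 h8) (mul_pos h6 h7)
        have h10 : (ε * ((-1) ^ changesUpTo v (f ⟨i, by omega⟩) * v (f ⟨i, by omega⟩)) *
            (δ * ((-1) ^ i * -1 * v (f ⟨i + 1, hi⟩)))) *
            (ε * ((-1) ^ changesUpTo v (f ⟨i, by omega⟩) * v (f ⟨i + 1, hi⟩)) *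
            (δ * ((-1) ^ i * v (f ⟨i, by omega⟩)))) =
            -((ε * (-1) ^ changesUpTo v (f ⟨i, by omega⟩) * v (f ⟨i, by omega⟩) *
            (δ * ((-1) ^ i * v (f ⟨i + 1, hi⟩)))) ^ 2) := by ring
        rw [h10] at h9
        exact absurd h9 (by simpa using sq_nonneg _)
    exact (key k (Nat.lt_succ_self k)).trans (changesUpTo_le v _)

theorem signVar_lt_iff {v : ι → ℝ} {k : ℕ} : signVar v ≤ (k : ℤ) - 1 ↔ ¬ (k : ℤ) ≤ signVar v := by
  omega

theorem isOpen_le_signVar (k : ℕ) : IsOpen {v : ι → ℝ | (k : ℤ) ≤ signVar v} := by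
  simp only [le_signVar_iff, Set.ofPred_exists, Set.ofPred_and, Set.ofPred_forall]
  refine isOpen_iUnion fun f => IsOpen.inter isOpen_const (isOpen_iUnion fun ε =>
    isOpen_iInter_of_finite fun i => isOpen_lt continuous_const (by fun_prop))

/-- Deleting entries and replacing entries by zero do not increase the sign variation. -/
theorem le_signVar_of_conformal {κ : Type*} [Fintype κ] [LinearOrder κ] {v : ι → ℝ} {w : κ → ℝ}
    {g : κ → ι} (hg : StrictMono g) (h : ∀ i, w i ≠ 0 → 0 < w i * v (g i)) {k : ℕ}
    (hw : (k : ℤ) ≤ signVar w) : (k : ℤ) ≤ signVar v := by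
  obtain ⟨f, hf, ε, hε⟩ := le_signVar_iff.1 hw
  refine le_signVar_iff.2 ⟨g ∘ f, hg.comp hf, ε, fun i => ?_⟩
  have h1 := h (f i) (right_ne_zero_of_mul (right_ne_zero_of_mul (hε i).ne'))
  have h2 := mul_pos (hε i) h1
  have h3 : 0 < (w (f i)) ^ 2 := by
    have := right_ne_zero_of_mul (right_ne_zero_of_mul (hε i).ne')
    positivity
  have h4 : ε * ((-1) ^ (i : ℕ) * w (f i)) * (w (f i) * v (g (f i))) =
    (w (f i)) ^ 2 * (ε * ((-1) ^ (i : ℕ) * v (g (f i)))) := by ring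
  rw [h4] at h2
  exact (pos_iff_pos_of_mul_pos h2).1 h3

/-- Restricting to a set of positions containing the support does not change the variation. -/
theorem le_signVar_restrict_iff {I : Finset ι} {v : ι → ℝ} (hv : ∀ i ∈ I, v i = 0) {k : ℕ} :
    (k : ℤ) ≤ signVar (fun j : {j // j ∉ I} => v j) ↔ (k : ℤ) ≤ signVar v := by
  constructor
  · exact le_signVar_of_conformal (g := Subtype.val) (fun _ _ h => h) fun i hi => mul_self_pos.2 hi
  · intro h
    obtain ⟨f, hf, ε, hε⟩ := le_signVar_iff.1 h
    have h0 : ∀ i, f i ∉ I := fun i hi => by simpa [hv _ hi] using hε i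
    exact le_signVar_iff.2 ⟨fun i => ⟨f i, h0 i⟩, fun _ _ h => hf h, ε, hε⟩

theorem le_signVar_smul_iff {v : ι → ℝ} {c : ℝ} (hc : c ≠ 0) {k : ℕ} :
    (k : ℤ) ≤ signVar (fun i => c * v i) ↔ (k : ℤ) ≤ signVar v := by
  simp only [le_signVar_iff]
  refine exists_congr fun f => and_congr_right fun _ => ⟨?_, ?_⟩
  · rintro ⟨ε, h⟩
    exact ⟨ε * c, fun i => by convert h i using 1; ring⟩
  · rintro ⟨ε, h⟩
    exact ⟨ε * c⁻¹, fun i => by convert h i using 1; field_simp⟩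

end SignVariation

/-! ### Sign variation of the alternated sequence -/

section Alternating

/-- The sequence `((-1)^j v_j)_j`. -/
def altSeq {n : ℕ} (v : Fin n → ℝ) (j : Fin n) : ℝ := (-1) ^ (j : ℕ) * v j

theorem altSeq_mul_altSeq {n : ℕ} (v : Fin n → ℝ) (q p : Fin n) :
    altSeq v q * altSeq v p = (-1) ^ ((q : ℕ) + p) * (v q * v p) := by
  simp only [altSeq, pow_add]; ring

theorem altSeq_eq_zero {n : ℕ} {v : Fin n → ℝ} {j : Fin n} : altSeq v j = 0 ↔ v j = 0 := by
  simp [altSeq]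

/-- This is var(v) + var(alt v) ≤ n - 1. The union of the two sets of changes omits the first
nonzero position, and their intersection is no larger than the number of zeros. -/
theorem card_signChanges_add_card_altSeq_lt {n : ℕ} {v : Fin n → ℝ} (hv : v ≠ 0) :
    (signChanges v).card + (signChanges (altSeq v)).card < n := by
  classical
  obtain ⟨j, hj⟩ := Function.ne_iff.1 hv
  obtain ⟨a, ha⟩ := (Finset.univ.filter fun l => v l ≠ 0).exists_minimal ⟨j, by simpa using hj⟩
  have ha0 : v a ≠ 0 := by simpa using ha.1
  have hmin : ∀ l, v l ≠ 0 → a ≤ l := fun l hl => by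
    by_contra h0
    exact h0 (ha.2 (by simpa using hl) (not_le.1 h0).le)
  have h1 : signChanges v ∪ signChanges (altSeq v) ⊆
      (Finset.univ.filter fun l => v l ≠ 0).erase a := by
    intro p hp
    have : v p ≠ 0 ∧ ∃ q < p, v q ≠ 0 := by
      rcases Finset.mem_union.1 hp with hp | hp
      · obtain ⟨q, h, h', -⟩ := mem_signChanges.1 hp
        exact ⟨ne_zero_of_mem_signChanges hp, q, h, left_ne_zero_of_mul h'.ne⟩
      · obtain ⟨q, h, h', -⟩ := mem_signChanges.1 hp
        exact ⟨fun h => ne_zero_of_mem_signChanges hp (altSeq_eq_zero.2 h), q, h,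
          fun h => left_ne_zero_of_mul h'.ne (altSeq_eq_zero.2 h)⟩
    obtain ⟨h, q, hq, hq'⟩ := this
    refine Finset.mem_erase.2 ⟨?_, by simpa using h⟩
    rintro rfl
    exact not_le_of_gt hq (hmin q hq')
  have h2 : (signChanges v ∩ signChanges (altSeq v)).card ≤
      (Finset.univ.filter fun l => ¬ v l ≠ 0).card := by
    have hp : ∀ p ∈ signChanges v ∩ signChanges (altSeq v),
        ∃ l : Fin n, (l : ℕ) + 1 = p ∧ v l = 0 := by
      intro p hp
      obtain ⟨hp1, hp2⟩ := Finset.mem_inter.1 hp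
      obtain ⟨q, a1, a2, a3⟩ := mem_signChanges.1 hp1
      obtain ⟨q', b1, b2, b3⟩ := mem_signChanges.1 hp2
      have : q' = q := eq_of_isPrev (v := v) (left_ne_zero_of_mul a2.ne) a1 a3
        (fun h => left_ne_zero_of_mul b2.ne (altSeq_eq_zero.2 h)) b1
        fun l h h' => altSeq_eq_zero.1 (b3 l h h')
      subst this
      rw [altSeq_mul_altSeq] at b2
      -- A change common to both sequences forces `p - q'` to be even, so `p - 1` lies strictly
      -- after `q'` and carries a zero entry; `p ↦ p - 1` is the injection.
      have hne : (p : ℕ) ≠ q' + 1 := by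
        intro h
        rw [h, show (q' : ℕ) + (q' + 1) = 2 * q' + 1 by ring, pow_succ, pow_mul] at b2
        norm_num at b2
        linarith
      have hlt : (q' : ℕ) < p := a1
      refine ⟨⟨p - 1, by omega⟩, by simp; omega, a3 _ ?_ ?_⟩
      · rw [Fin.lt_def]; simp; omega
      · rw [Fin.lt_def]; simp; omega
    choose! g hg using hp
    refine Finset.card_le_card_of_injOn g (fun p hp => ?_) fun p hp p' hp' h => ?_
    · simpa using (hg p hp).2
    · have h1 := (hg p hp).1
      have h2 := (hg p' hp').1
      rw [h] at h1
      exact Fin.ext (h1.symm.trans h2)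
  have h3 := Finset.card_union_add_card_inter (signChanges v) (signChanges (altSeq v))
  have h4 := Finset.card_le_card h1
  rw [Finset.card_erase_of_mem (by simpa using ha0)] at h4
  have h5 := Finset.card_filter_add_card_filter_not (s := (Finset.univ : Finset (Fin n)))
    (fun l => v l ≠ 0)
  have h6 : 0 < (Finset.univ.filter fun l => v l ≠ 0).card := Finset.card_pos.2 ⟨a, by simpa using ha0⟩
  rw [Finset.card_univ, Fintype.card_fin] at h5
  omega

theorem signVar_altSeq_le {n k : ℕ} (hk : k ≤ n) {v : Fin n → ℝ}
    (h : v ≠ 0 → (k : ℤ) ≤ signVar v) : signVar (altSeq v) ≤ ((n - k : ℕ) : ℤ) - 1 := by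
  by_cases hv : v = 0
  · have : altSeq v = 0 := by subst hv; ext; simp [altSeq]
    -- For `k = n` the bound is `-1`, which the zero vector meets thanks to the convention var(0) =
    -- -1.
    rw [this, signVar, if_pos rfl]
    omega
  · have h1 := h hv
    have h2 : altSeq v ≠ 0 := fun h' => hv (funext fun j => altSeq_eq_zero.1 (congrFun h' j))
    rw [signVar_of_ne_zero hv] at h1
    rw [signVar_of_ne_zero h2]
    have := card_signChanges_add_card_altSeq_lt hv
    omega

/-- If `v` has few sign changes, then `((-1)^j v_j)` alternates weakly on many positions. -/
theorem exists_weakly_alternating {n d : ℕ} {v : Fin n → ℝ} (hv : v ≠ 0) (hd : d ≤ n)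
    (h : ¬ (d : ℤ) ≤ signVar v) : ∃ f : Fin (n - d + 1) → Fin n, StrictMono f ∧
      ∃ ε : ℝ, ε ≠ 0 ∧ ∀ i : Fin (n - d + 1), 0 ≤ ε * ((-1) ^ (i : ℕ) * altSeq v (f i)) := by
  classical
  rw [signVar_of_ne_zero hv, Nat.cast_le, not_le] at h
  obtain ⟨ε, hε, hs⟩ := exists_sign v
  -- At the `i`-th position `j` outside the changes, `j` equals `i` plus the number of changes so
  -- far. Hence `(-1)^j` splits into `(-1)^i` and the factor that normalizes the sign of `v j`.
  set J := (signChanges v)ᶜ with hJ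
  have hJc : J.card = n - (signChanges v).card := by
    rw [hJ, Finset.card_compl, Fintype.card_fin]
  have hcnt : ∀ i : Fin (n - (signChanges v).card), (i : ℕ) +
      changesUpTo v (J.orderEmbOfFin hJc i) = J.orderEmbOfFin hJc i := by
    intro i
    set j := J.orderEmbOfFin hJc i with hj
    have hjJ : j ∈ J := J.orderEmbOfFin_mem hJc i
    have h1 : (J.filter (· < j)).card = i := card_filter_lt_orderEmbOfFin hJc i
    have h2 : changesUpTo v j = ((signChanges v).filter (· < j)).card := by
      rw [changesUpTo]
      congr 1
      ext p
      simp only [Finset.mem_filter, and_congr_right_iff]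
      intro hp
      refine ⟨fun h => lt_of_le_of_ne h ?_, le_of_lt⟩
      rintro rfl
      exact Finset.mem_compl.1 hjJ hp
    have h3 : (Finset.Iio j).card = (J.filter (· < j)).card +
        ((signChanges v).filter (· < j)).card := by
      rw [← Finset.card_union_of_disjoint]
      · congr 1
        ext p
        simp only [Finset.mem_Iio, Finset.mem_union, Finset.mem_filter, hJ, Finset.mem_compl]
        tauto
      · rw [Finset.disjoint_left]
        intro p hp hp'
        exact Finset.mem_compl.1 (Finset.mem_filter.1 hp).1 (Finset.mem_filter.1 hp').1
    rw [h1, Fin.card_Iio] at h3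
    omega
  have hle : n - d + 1 ≤ n - (signChanges v).card := by omega
  refine ⟨fun i => J.orderEmbOfFin hJc (Fin.castLE hle i),
    (J.orderEmbOfFin hJc).strictMono.comp (Fin.strictMono_castLE hle), ε, hε, fun i => ?_⟩
  set i' := Fin.castLE hle i
  have h1 := hcnt i'
  by_cases h0 : v (J.orderEmbOfFin hJc i') = 0
  · rw [altSeq_eq_zero.2 h0]; simp
  · have h2 := hs _ h0
    rw [altSeq, ← h1, pow_add]
    have h3 : ((-1 : ℝ) ^ (i : ℕ)) * ((-1) ^ (i : ℕ)) = 1 := by rw [← mul_pow]; simp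
    calc (0 : ℝ) ≤ _ := h2.le
      _ = ((-1 : ℝ) ^ (i : ℕ)) * ((-1) ^ (i : ℕ)) * _ := by rw [h3, one_mul]
      _ = _ := by simp only [i', Fin.val_castLE]; ring

end Alternating

/-! ### Moving between subsets by adjacent transpositions -/

section AdjacentSwaps

/-- `a` and `b` are consecutive. -/
def Adjacent {n : ℕ} (a b : Fin n) : Prop := (a : ℕ) + 1 = b ∨ (b : ℕ) + 1 = a

theorem Adjacent.symm {n : ℕ} {a b : Fin n} (h : Adjacent a b) : Adjacent b a := Or.symm h

theorem Adjacent.ne {n : ℕ} {a b : Fin n} (h : Adjacent a b) : a ≠ b := by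
  rintro rfl
  rcases h with h | h <;> omega

/-- The image of a finset under a transposition. -/
abbrev swapped {n : ℕ} (a b : Fin n) (J : Finset (Fin n)) : Finset (Fin n) :=
  J.map (Equiv.swap a b).toEmbedding

theorem card_swapped {n d : ℕ} {a b : Fin n} {J : Finset (Fin n)} (hJ : J.card = d) :
    (swapped a b J).card = d := by rw [Finset.card_map, hJ]

theorem mem_swapped {n : ℕ} {a b x : Fin n} {J : Finset (Fin n)} :
    x ∈ swapped a b J ↔ Equiv.swap a b x ∈ J := by
  rw [Finset.mem_map_equiv, Equiv.symm_swap]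

theorem swapped_swapped {n : ℕ} (a b : Fin n) (J : Finset (Fin n)) :
    swapped a b (swapped a b J) = J := by
  ext x
  simp

theorem swapped_comm {n : ℕ} (a b : Fin n) (J : Finset (Fin n)) :
    swapped a b J = swapped b a J := by
  rw [swapped, Equiv.swap_comm]

theorem swapped_compl {n : ℕ} (a b : Fin n) (J : Finset (Fin n)) :
    swapped a b Jᶜ = (swapped a b J)ᶜ := by
  ext x
  rw [Finset.mem_compl, mem_swapped, mem_swapped, Finset.mem_compl]

/-- No element lies between `a` and `b`, so the swap can reverse an order relation only for the pair
`a`, `b` itself, which `J` does not contain. -/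
theorem orderEmbOfFin_swapped {n d : ℕ} {a b : Fin n} (hab : Adjacent a b) {J : Finset (Fin n)}
    (hJ : J.card = d) (h : ¬ (a ∈ J ∧ b ∈ J)) :
    ⇑((swapped a b J).orderEmbOfFin (card_swapped hJ)) = Equiv.swap a b ∘ J.orderEmbOfFin hJ := by
  refine (Finset.orderEmbOfFin_unique _ (fun x => ?_) fun i j hij => ?_).symm
  · rw [mem_swapped, Function.comp_apply, Equiv.swap_apply_self]
    exact J.orderEmbOfFin_mem hJ x
  · have h1 : J.orderEmbOfFin hJ i < J.orderEmbOfFin hJ j := (J.orderEmbOfFin hJ).strictMono hij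
    have hi := J.orderEmbOfFin_mem hJ i
    have hj := J.orderEmbOfFin_mem hJ j
    simp only [Function.comp_apply]
    generalize J.orderEmbOfFin hJ i = x at *
    generalize J.orderEmbOfFin hJ j = y at *
    rw [Equiv.swap_apply_def, Equiv.swap_apply_def]
    rw [Adjacent] at hab
    split_ifs with h2 h3 h4 h5 h6 h7 h8 <;> subst_vars <;>
      simp only [Fin.lt_def, Fin.ext_iff] at * <;> first | omega | grind

/-- Any two finsets of the same cardinality are connected by moves of an element to an adjacent
free position. -/
theorem adjacent_swap_induction {n k : ℕ} {Q : Finset (Fin n) → Prop} {J₀ : Finset (Fin n)}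
    (h₀ : J₀.card = k) (hQ : Q J₀)
    (step : ∀ a b J, Adjacent a b → a ∈ J → b ∉ J → J.card = k → Q J → Q (swapped a b J))
    {J : Finset (Fin n)} (hJ : J.card = k) : Q J := by
  rcases n with _ | n
  · rwa [Subsingleton.elim J J₀]
  have e0 : {x // x ∈ J₀} ≃ {x // x ∈ J} := Fintype.equivOfCardEq (by simp [h₀, hJ])
  have hσ : J₀.map e0.extendSubtype.toEmbedding = J := by
    refine Finset.eq_of_subset_of_card_le (fun x hx => ?_) (by rw [Finset.card_map, h₀, hJ])
    obtain ⟨y, hy, rfl⟩ := Finset.mem_map.1 hx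
    exact e0.extendSubtype_mem y hy
  -- Adjacent transpositions generate the symmetric group. One of them fixes `K` when it meets `K`
  -- in both points or in none, and otherwise it is an admissible move.
  have key : ∀ σ : Equiv.Perm (Fin (n + 1)), ∀ K : Finset (Fin (n + 1)), K.card = k → Q K →
      Q (K.map σ.toEmbedding) := by
    intro σ
    have hm : σ ∈ Submonoid.closure
        (Set.range fun i : Fin n => Equiv.swap i.castSucc i.succ) := by
      rw [Equiv.Perm.mclosure_swap_castSucc_succ]; trivial
    induction hm using Submonoid.closure_induction with
    | mem x hx =>
      obtain ⟨i, rfl⟩ := hx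
      intro K hK hQK
      have hadj : Adjacent i.castSucc i.succ := Or.inl (by simp)
      by_cases h1 : i.castSucc ∈ K <;> by_cases h2 : i.succ ∈ K
      · convert hQK using 1
        ext x
        change x ∈ swapped _ _ K ↔ _
        rw [mem_swapped, Equiv.swap_apply_def]
        split_ifs with h3 h4 <;> simp_all
      · exact step _ _ K hadj h1 h2 hK hQK
      · have := step _ _ K hadj.symm h2 h1 hK hQK
        rwa [swapped_comm] at this
      · convert hQK using 1
        ext x
        change x ∈ swapped _ _ K ↔ _
        rw [mem_swapped, Equiv.swap_apply_def]
        split_ifs with h3 h4 <;> simp_all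
    | one =>
      intro K _ hQK
      convert hQK using 1
      exact Finset.map_refl
    | mul σ τ _ _ hs ht =>
      intro K hK hQK
      have := hs _ (by rw [Finset.card_map, hK]) (ht K hK hQK)
      rw [Finset.map_map] at this
      exact this
  rw [← hσ]
  exact key _ _ h₀ hQ

end AdjacentSwaps

/-! ### Maximal minors under elementary column operations -/

section Minors

variable {d n : ℕ}

theorem minor_congr (A : Matrix (Fin d) (Fin n) ℝ) {I J : Finset (Fin n)} (h : I = J)
    (hI : I.card = d) : minor A I hI = minor A J (h ▸ hI) := by
  subst h; rfl

theorem minor_eq_det_of_strictMono (A : Matrix (Fin d) (Fin n) ℝ) {f : Fin d → Fin n}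
    (hf : StrictMono f) : ∃ (I : Finset (Fin n)) (hI : I.card = d),
      (A.submatrix id f).det = minor A I hI := by
  classical
  have hI : (Finset.univ.image f).card = d := by
    rw [Finset.card_image_of_injective _ hf.injective, Finset.card_fin]
  refine ⟨_, hI, ?_⟩
  rw [minor, ← Finset.orderEmbOfFin_unique hI (fun x => Finset.mem_image_of_mem _
    (Finset.mem_univ x)) hf]

theorem mul_transvection_apply (A : Matrix (Fin d) (Fin n) ℝ) (a b : Fin n) (t : ℝ) (x : Fin d)
    (j : Fin n) : (A * Matrix.transvection a b t) x j =
      A x j + if j = b then t * A x a else 0 := by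
  rw [Matrix.transvection, Matrix.mul_add, Matrix.mul_one, Matrix.add_apply]
  congr 1
  split_ifs with h
  · subst h
    rw [Matrix.mul_single_apply_same, mul_comm]
  · rw [Matrix.mul_single_apply_of_ne _ _ _ _ _ h]

theorem minor_mul_transvection_of_notMem (A : Matrix (Fin d) (Fin n) ℝ) {a b : Fin n} (t : ℝ)
    {J : Finset (Fin n)} (hJ : J.card = d) (hb : b ∉ J) :
    minor (A * Matrix.transvection a b t) J hJ = minor A J hJ := by
  rw [minor, minor]
  congr 1
  ext x j
  rw [Matrix.submatrix_apply, Matrix.submatrix_apply, mul_transvection_apply, if_neg, add_zero]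
  rintro rfl
  exact hb (J.orderEmbOfFin_mem hJ j)

theorem minor_mul_transvection_of_mem (A : Matrix (Fin d) (Fin n) ℝ) {a b : Fin n} (t : ℝ)
    {J : Finset (Fin n)} (hJ : J.card = d) {p : Fin d} (hp : J.orderEmbOfFin hJ p = b) :
    minor (A * Matrix.transvection a b t) J hJ = minor A J hJ +
      t * ((A.submatrix id (J.orderEmbOfFin hJ)).updateCol p fun x => A x a).det := by
  rw [minor, minor, ← Matrix.det_updateCol_smul]
  conv_rhs => rw [← Matrix.updateCol_eq_self (A.submatrix id (J.orderEmbOfFin hJ)) p]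
  rw [Matrix.updateCol_idem, ← Matrix.det_updateCol_add]
  congr 1
  ext x j
  rw [Matrix.submatrix_apply, mul_transvection_apply, Matrix.updateCol_apply]
  have : J.orderEmbOfFin hJ j = b ↔ j = p := by
    rw [← hp]; exact (J.orderEmbOfFin hJ).injective.eq_iff
  by_cases h : j = p
  · subst h
    simp [hp]
  · simp [h, this]

theorem minor_mul_transvection_of_mem_of_mem (A : Matrix (Fin d) (Fin n) ℝ) {a b : Fin n}
    (hab : a ≠ b) (t : ℝ) {J : Finset (Fin n)} (hJ : J.card = d) (hb : b ∈ J) (ha : a ∈ J) :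
    minor (A * Matrix.transvection a b t) J hJ = minor A J hJ := by
  obtain ⟨p, hp⟩ : b ∈ Set.range (J.orderEmbOfFin hJ) := by
    rw [Finset.range_orderEmbOfFin]; exact hb
  obtain ⟨q, hq⟩ : a ∈ Set.range (J.orderEmbOfFin hJ) := by
    rw [Finset.range_orderEmbOfFin]; exact ha
  have hpq : q ≠ p := by
    rintro rfl
    exact hab (hq.symm.trans hp)
  rw [minor_mul_transvection_of_mem A t hJ hp, Matrix.det_zero_of_column_eq hpq, mul_zero, add_zero]
  intro x
  simp [hpq, hq]

/-- Expand in the modified column `b`. Putting column `a` in its place gives the minor on `J` with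
no sign, because adjacency keeps the columns in increasing order. -/
theorem minor_mul_transvection_of_adjacent (A : Matrix (Fin d) (Fin n) ℝ) {a b : Fin n}
    (hab : Adjacent a b) (t : ℝ) {J : Finset (Fin n)} (hJ : J.card = d) (ha : a ∈ J) (hb : b ∉ J) :
    minor (A * Matrix.transvection a b t) (swapped a b J) (card_swapped hJ) =
      minor A (swapped a b J) (card_swapped hJ) + t * minor A J hJ := by
  obtain ⟨p, hp⟩ : a ∈ Set.range (J.orderEmbOfFin hJ) := by
    rw [Finset.range_orderEmbOfFin]; exact ha
  have he := orderEmbOfFin_swapped hab hJ fun h => hb h.2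
  rw [minor_mul_transvection_of_mem A t (card_swapped hJ) (p := p) (by simp [he, hp])]
  congr 2
  rw [minor]
  congr 1
  ext x j
  rw [Matrix.updateCol_apply, Matrix.submatrix_apply, Matrix.submatrix_apply, he]
  split_ifs with h
  · rw [h, hp, id]
  · rw [Function.comp_apply, Equiv.swap_apply_of_ne_of_ne]
    · rw [← hp]
      exact fun h' => h ((J.orderEmbOfFin hJ).injective h')
    · intro h'
      exact hb (h' ▸ J.orderEmbOfFin_mem hJ j)

theorem minor_le_minor_mul_transvection {A : Matrix (Fin d) (Fin n) ℝ}
    (hA : ∀ (I : Finset (Fin n)) (hI : I.card = d), 0 ≤ minor A I hI) {a b : Fin n}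
    (hab : Adjacent a b) {t : ℝ} (ht : 0 ≤ t) {J : Finset (Fin n)} (hJ : J.card = d) :
    minor A J hJ ≤ minor (A * Matrix.transvection a b t) J hJ := by
  by_cases hb : b ∈ J
  · by_cases ha : a ∈ J
    · rw [minor_mul_transvection_of_mem_of_mem A hab.ne t hJ hb ha]
    · have h1 : a ∈ swapped a b J := by rw [mem_swapped]; simpa using hb
      have h2 : b ∉ swapped a b J := by rw [mem_swapped]; simpa using ha
      have h3 := minor_mul_transvection_of_adjacent A hab t (card_swapped hJ) h1 h2
      rw [minor_congr _ (swapped_swapped a b J), minor_congr A (swapped_swapped a b J)] at h3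
      rw [h3]
      exact le_add_of_nonneg_right (mul_nonneg ht (hA _ _))
  · rw [minor_mul_transvection_of_notMem A t hJ hb]

/-- A product of elementary matrices `1 + t E_{a,b}`. -/
def transvectionProd (t : ℝ) (l : List (Fin n × Fin n)) : Matrix (Fin n) (Fin n) ℝ :=
  (l.map fun p => Matrix.transvection p.1 p.2 t).prod

theorem continuous_transvectionProd (l : List (Fin n × Fin n)) :
    Continuous fun t : ℝ => transvectionProd t l := by
  induction l with
  | nil => simpa [transvectionProd] using continuous_const
  | cons p l ih =>
    simp only [transvectionProd, List.map_cons, List.prod_cons]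
    refine Continuous.mul ?_ ih
    refine continuous_pi fun i => continuous_pi fun j => ?_
    simp only [Matrix.transvection, Matrix.add_apply, Matrix.single_apply]
    split_ifs <;> fun_prop

theorem transvectionProd_zero (l : List (Fin n × Fin n)) : transvectionProd 0 l = 1 := by
  simp [transvectionProd]

theorem minor_le_minor_mul_transvectionProd {l : List (Fin n × Fin n)}
    (hl : ∀ p ∈ l, Adjacent p.1 p.2) {t : ℝ} (ht : 0 ≤ t) {A : Matrix (Fin d) (Fin n) ℝ}
    (hA : ∀ (I : Finset (Fin n)) (hI : I.card = d), 0 ≤ minor A I hI)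
    (J : Finset (Fin n)) (hJ : J.card = d) :
    minor A J hJ ≤ minor (A * transvectionProd t l) J hJ := by
  induction l generalizing A with
  | nil => simp [transvectionProd]
  | cons p l ih =>
    have hp := hl p (by simp)
    have h1 := ih (fun q hq => hl q (by simp [hq])) (A := A * Matrix.transvection p.1 p.2 t)
      fun I hI => (hA I hI).trans (minor_le_minor_mul_transvection hA hp ht hI)
    rw [Matrix.mul_assoc] at h1
    exact (minor_le_minor_mul_transvection hA hp ht hJ).trans h1

/-- To make the minor on `J` positive, walk from `I₀` to `J` by adjacent moves; each move appends a
factor adding `t` times the minor just made positive. Later factors never decrease a minor, so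
positivity already gained persists. The list does not depend on `t`. -/
theorem exists_transvectionProd_minor_pos {A : Matrix (Fin d) (Fin n) ℝ}
    (hA : ∀ (I : Finset (Fin n)) (hI : I.card = d), 0 ≤ minor A I hI) {I₀ : Finset (Fin n)}
    {hI₀ : I₀.card = d} (h₀ : minor A I₀ hI₀ ≠ 0) (S : Finset (Finset (Fin n))) :
    ∃ l : List (Fin n × Fin n), (∀ p ∈ l, Adjacent p.1 p.2) ∧ ∀ t : ℝ, 0 < t →
      ∀ I ∈ S, ∀ hI : I.card = d, 0 < minor (A * transvectionProd t l) I hI := by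
  classical
  induction S using Finset.induction_on with
  | empty => exact ⟨[], by simp, by simp⟩
  | insert J S _ ih =>
    obtain ⟨l, hl, hS⟩ := ih
    have hB : ∀ t : ℝ, 0 < t → ∀ (I : Finset (Fin n)) (hI : I.card = d),
        0 ≤ minor (A * transvectionProd t l) I hI := fun t ht I hI =>
      (hA I hI).trans (minor_le_minor_mul_transvectionProd hl ht.le hA I hI)
    by_cases hJ : J.card = d
    · obtain ⟨l', hl', h'⟩ : ∃ l' : List (Fin n × Fin n), (∀ p ∈ l', Adjacent p.1 p.2) ∧
          ∀ t : ℝ, 0 < t → ∀ hJ : J.card = d,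
            0 < minor (A * transvectionProd t l * transvectionProd t l') J hJ := by
        refine adjacent_swap_induction (Q := fun J => ∃ l' : List (Fin n × Fin n),
          (∀ p ∈ l', Adjacent p.1 p.2) ∧ ∀ t : ℝ, 0 < t → ∀ hJ : J.card = d,
            0 < minor (A * transvectionProd t l * transvectionProd t l') J hJ) hI₀ ?_ ?_ hJ
        · refine ⟨[], by simp, fun t ht _ => ?_⟩
          have := minor_le_minor_mul_transvectionProd hl ht.le hA I₀ hI₀
          simpa [transvectionProd] using
            (lt_of_le_of_ne (hA _ _) h₀.symm).trans_le this
        · rintro a b K hab ha hb hK ⟨l', hl', h⟩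
          refine ⟨l' ++ [(a, b)], ?_, fun t ht _ => ?_⟩
          · intro p hp
            rcases List.mem_append.1 hp with hp | hp
            · exact hl' p hp
            · rw [List.mem_singleton.1 hp]; exact hab
          · have h1 : transvectionProd t (l' ++ [(a, b)]) =
                transvectionProd t l' * Matrix.transvection a b t := by
              simp [transvectionProd]
            rw [h1, ← Matrix.mul_assoc, minor_mul_transvection_of_adjacent _ hab t hK ha hb]
            have h2 := minor_le_minor_mul_transvectionProd hl' ht.le (hB t ht) (swapped a b K)
              (card_swapped hK)
            exact add_pos_of_nonneg_of_pos ((hB t ht _ _).trans h2) (mul_pos ht (h t ht hK))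
      refine ⟨l ++ l', ?_, fun t ht I hI hI' => ?_⟩
      · intro p hp
        rcases List.mem_append.1 hp with hp | hp
        exacts [hl p hp, hl' p hp]
      · have h1 : transvectionProd t (l ++ l') = transvectionProd t l * transvectionProd t l' := by
          simp [transvectionProd]
        rw [h1, ← Matrix.mul_assoc]
        rcases Finset.mem_insert.1 hI with rfl | hI
        · exact h' t ht _
        · exact (hS t ht I hI hI').trans_le
            (minor_le_minor_mul_transvectionProd hl' ht.le (hB t ht) I hI')
    · refine ⟨l, hl, fun t ht I hI hI' => ?_⟩
      rcases Finset.mem_insert.1 hI with rfl | hI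
      exacts [absurd hI' hJ, hS t ht I hI hI']

/-- A matrix with nonnegative maximal minors, not all zero, is a limit of matrices with positive
maximal minors. -/
theorem exists_perturbation_minor_pos {A : Matrix (Fin d) (Fin n) ℝ}
    (hA : ∀ (I : Finset (Fin n)) (hI : I.card = d), 0 ≤ minor A I hI) {I₀ : Finset (Fin n)}
    {hI₀ : I₀.card = d} (h₀ : minor A I₀ hI₀ ≠ 0) :
    ∃ G : ℝ → Matrix (Fin n) (Fin n) ℝ, Continuous G ∧ G 0 = 1 ∧ ∀ t : ℝ, 0 < t →
      ∀ (I : Finset (Fin n)) (hI : I.card = d), 0 < minor (A * G t) I hI := by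
  obtain ⟨l, -, h⟩ := exists_transvectionProd_minor_pos hA h₀ Finset.univ
  exact ⟨fun t => transvectionProd t l, continuous_transvectionProd l, transvectionProd_zero l,
    fun t ht I hI => h t ht I (Finset.mem_univ _) hI⟩

theorem linearIndependent_rowVec_iff {A : Matrix (Fin d) (Fin n) ℝ} :
    LinearIndependent ℝ (rowVec A) ↔ LinearIndependent ℝ A.row := by
  have : A.row = (WithLp.linearEquiv 2 ℝ (Fin n → ℝ)) ∘ rowVec A := rfl
  rw [this]
  exact (LinearMap.linearIndependent_iff (WithLp.linearEquiv 2 ℝ (Fin n → ℝ)).toLinearMap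
    (LinearEquiv.ker _)).symm

theorem exists_minor_ne_zero {A : Matrix (Fin d) (Fin n) ℝ} (hA : LinearIndependent ℝ (rowVec A)) :
    ∃ (I : Finset (Fin n)) (hI : I.card = d), minor A I hI ≠ 0 := by
  classical
  have hr : A.rank = d := by
    rw [(linearIndependent_rowVec_iff.1 hA).rank_matrix, Fintype.card_fin]
  rw [Matrix.rank_eq_finrank_span_cols] at hr
  have hex := Submodule.exists_fun_fin_finrank_span_eq ℝ (Set.range A.col)
  rw [hr] at hex
  obtain ⟨f, hf, -, hli⟩ := hex
  choose g hg using hf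
  have hginj : Function.Injective g := fun i j h => hli.injective (by rw [← hg, ← hg, h])
  have hI : (Finset.univ.image g).card = d := by
    rw [Finset.card_image_of_injective _ hginj, Finset.card_fin]
  refine ⟨_, hI, ?_⟩
  -- The independent columns come in the order of `g`, while a minor lists them increasingly; `τ` is
  -- the reordering.
  have hτ : ∀ i, ∃ i', g i' = (Finset.univ.image g).orderEmbOfFin hI i := fun i => by
    obtain ⟨i', -, h⟩ := Finset.mem_image.1 ((Finset.univ.image g).orderEmbOfFin_mem hI i)
    exact ⟨i', h⟩
  choose τ hτ using hτ
  have hτinj : Function.Injective τ := fun i j h =>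
    ((Finset.univ.image g).orderEmbOfFin hI).injective (by rw [← hτ, ← hτ, h])
  have heq : (A.submatrix id ((Finset.univ.image g).orderEmbOfFin hI)).col = f ∘ τ := by
    ext i x
    rw [Function.comp_apply, ← hg, hτ]
    rfl
  have h1 : LinearIndependent ℝ (A.submatrix id ((Finset.univ.image g).orderEmbOfFin hI)).col := by
    rw [heq]
    exact hli.comp τ hτinj
  exact ((Matrix.isUnit_iff_isUnit_det _).1
    (Matrix.linearIndependent_cols_iff_isUnit.1 h1)).ne_zero

end Minors

/-! ### Row spans and the alternating involution -/

section RowSpan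

variable {d n : ℕ}

theorem mem_rowSpan {A : Matrix (Fin d) (Fin n) ℝ} {x : E n} :
    x ∈ rowSpan A ↔ ∃ c : Fin d → ℝ, x.ofLp = Matrix.vecMul c A := by
  rw [rowSpan, Submodule.mem_span_range_iff_exists_fun]
  refine exists_congr fun c => ?_
  rw [← (WithLp.ofLp_injective 2).eq_iff, eq_comm]
  have : (∑ i, c i • rowVec A i).ofLp = Matrix.vecMul c A := by
    ext j
    simp [Matrix.vecMul, dotProduct, rowVec, WithLp.ofLp_sum]
  rw [this]

theorem exists_rowSpan_eq {S : Submodule ℝ (E n)} (hS : Module.finrank ℝ S = d) :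
    ∃ C : Matrix (Fin d) (Fin n) ℝ, LinearIndependent ℝ (rowVec C) ∧ rowSpan C = S := by
  let b := Module.finBasisOfFinrankEq ℝ S hS
  have h : (rowVec fun i => (b i : E n).ofLp) = S.subtype ∘ b := rfl
  refine ⟨fun i => (b i : E n).ofLp, ?_, ?_⟩
  · rw [h]
    exact b.linearIndependent.map' _ S.ker_subtype
  · change Submodule.span ℝ (Set.range (rowVec fun i => (b i : E n).ofLp)) = S
    rw [h, Set.range_comp, ← Submodule.map_span, b.span_eq, Submodule.map_subtype_top]

theorem linearIndependent_of_finrank_rowSpan {A : Matrix (Fin d) (Fin n) ℝ}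
    (h : Module.finrank ℝ (rowSpan A) = d) : LinearIndependent ℝ (rowVec A) := by
  rw [linearIndependent_iff_card_eq_finrank_span, Fintype.card_fin]
  exact h.symm

theorem vecMul_injective {A : Matrix (Fin d) (Fin n) ℝ} (hA : LinearIndependent ℝ (rowVec A)) :
    Function.Injective fun c => Matrix.vecMul c A :=
  Matrix.vecMul_injective_iff.2 (linearIndependent_rowVec_iff.1 hA)

theorem inner_eq_sum (x y : E n) : inner ℝ x y = ∑ j, x j * y j := by
  simp [PiLp.inner_apply, mul_comm]

/-- The involution `x ↦ ((-1)^j x_j)_j` of `ℝⁿ`. -/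
def altE (n : ℕ) : E n ≃ₗ[ℝ] E n :=
  LinearEquiv.ofInvolutive
    { toFun := fun x => WithLp.toLp 2 (altSeq x.ofLp)
      map_add' := fun x y => by ext j; simp [altSeq, mul_add]
      map_smul' := fun c x => by ext j; simp [altSeq]; ring }
    fun x => by
      ext j
      simp [altSeq, ← mul_assoc, ← mul_pow]

theorem altE_apply (x : E n) : (altE n x).ofLp = altSeq x.ofLp := rfl

theorem inner_altE (x y : E n) : inner ℝ (altE n x) y = inner ℝ x (altE n y) := by
  rw [inner_eq_sum, inner_eq_sum]
  refine Finset.sum_congr rfl fun j _ => ?_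
  simp only [altE_apply, altSeq]
  ring

end RowSpan

/-! ### Complementary minors of the orthogonal complement -/

section Duality

variable {d k n : ℕ}

theorem compl_card {I : Finset (Fin n)} (hk : d + k = n) (hI : I.card = d) : Iᶜ.card = k := by
  rw [Finset.card_compl, Fintype.card_fin, hI]; omega

/-- The permutation of `Fin n` listing `I` and then its complement. -/
def listingPerm (e : Fin d ⊕ Fin k ≃ Fin n) (hk : d + k = n) {I : Finset (Fin n)}
    (hI : I.card = d) : Equiv.Perm (Fin n) :=
  e.symm.trans (finSumEquivOfFinset hI (compl_card hk hI))

theorem listingPerm_swapped (e : Fin d ⊕ Fin k ≃ Fin n) (hk : d + k = n) {I : Finset (Fin n)}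
    (hI : I.card = d) {a b : Fin n} (hab : Adjacent a b) (ha : a ∈ I) (hb : b ∉ I) :
    listingPerm e hk (card_swapped (a := a) (b := b) hI) =
      (listingPerm e hk hI).trans (Equiv.swap a b) := by
  ext1 x
  simp only [listingPerm, Equiv.trans_apply]
  rcases e.symm x with y | y
  · rw [finSumEquivOfFinset_inl, finSumEquivOfFinset_inl,
      orderEmbOfFin_swapped hab hI fun h => hb h.2]
    rfl
  · rw [finSumEquivOfFinset_inr, finSumEquivOfFinset_inr]
    have h := congrFun (orderEmbOfFin_swapped hab (compl_card hk hI)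
      fun h => Finset.mem_compl.1 h.1 ha) y
    rw [Function.comp_apply] at h
    rw [← h]
    congr 2
    exact (swapped_compl a b I).symm

theorem prod_compl_swapped {I : Finset (Fin n)} {a b : Fin n} (hab : Adjacent a b) (ha : a ∈ I)
    (hb : b ∉ I) : ∏ j ∈ (swapped a b I)ᶜ, (-1 : ℝ) ^ (j : ℕ) =
      -∏ j ∈ Iᶜ, (-1 : ℝ) ^ (j : ℕ) := by
  rw [← swapped_compl, Finset.prod_map, ← Finset.mul_prod_erase _ _ (Finset.mem_compl.2 hb),
    ← Finset.mul_prod_erase Iᶜ _ (Finset.mem_compl.2 hb)]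
  have h1 : ∏ x ∈ Iᶜ.erase b, (-1 : ℝ) ^ (((Equiv.swap a b).toEmbedding x : Fin n) : ℕ) =
      ∏ x ∈ Iᶜ.erase b, (-1 : ℝ) ^ (x : ℕ) := by
    refine Finset.prod_congr rfl fun x hx => ?_
    have hxa : x ≠ a := by
      rintro rfl
      exact Finset.mem_compl.1 (Finset.mem_of_mem_erase hx) ha
    rw [Equiv.coe_toEmbedding, Equiv.swap_apply_of_ne_of_ne hxa (Finset.ne_of_mem_erase hx)]
  rw [h1, Equiv.coe_toEmbedding, Equiv.swap_apply_right, ← neg_mul]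
  congr 1
  rcases hab with h | h <;> rw [← h, pow_succ] <;> ring

/-- Up to a constant, the sign of the permutation listing `I` and then its complement is given by
the parity of the sum of the elements of the complement. -/
theorem exists_sign_listingPerm (e : Fin d ⊕ Fin k ≃ Fin n) (hk : d + k = n) :
    ∃ s : ℝ, ∀ (I : Finset (Fin n)) (hI : I.card = d),
      (∏ j ∈ Iᶜ, (-1 : ℝ) ^ (j : ℕ)) * ((Equiv.Perm.sign (listingPerm e hk hI) : ℤ) : ℝ) = s := by
  obtain ⟨I₀, -, hI₀⟩ := Finset.exists_subset_card_eq
    (s := (Finset.univ : Finset (Fin n))) (n := d) (by simp; omega)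
  refine ⟨(∏ j ∈ I₀ᶜ, (-1 : ℝ) ^ (j : ℕ)) *
    ((Equiv.Perm.sign (listingPerm e hk hI₀) : ℤ) : ℝ), fun I hI => ?_⟩
  refine adjacent_swap_induction (Q := fun I => ∀ hI : I.card = d,
    (∏ j ∈ Iᶜ, (-1 : ℝ) ^ (j : ℕ)) * ((Equiv.Perm.sign (listingPerm e hk hI) : ℤ) : ℝ) =
      (∏ j ∈ I₀ᶜ, (-1 : ℝ) ^ (j : ℕ)) * ((Equiv.Perm.sign (listingPerm e hk hI₀) : ℤ) : ℝ))
    hI₀ (fun _ => rfl) ?_ hI hI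
  -- An adjacent move flips both the sign of the permutation and the parity of the sum over the
  -- complement, so the product is invariant.
  intro a b J hab ha hb hJ h _
  rw [listingPerm_swapped e hk hJ hab ha hb, prod_compl_swapped hab ha hb, Equiv.Perm.sign_trans,
    Equiv.Perm.sign_swap hab.ne, ← h hJ]
  push_cast
  ring

theorem det_mul_transpose_self_ne_zero {A : Matrix (Fin d) (Fin n) ℝ}
    (hA : LinearIndependent ℝ (rowVec A)) : (A * A.transpose).det ≠ 0 := by
  intro h
  obtain ⟨v, hv, h0⟩ := Matrix.exists_vecMul_eq_zero_iff.2 h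
  have h1 : Matrix.vecMul v A = 0 :=
    (Matrix.vecMul_self_mul_conjTranspose_eq_zero A v).1 (by simpa using h0)
  exact hv (vecMul_injective hA (by simpa using h1))

/-- Complementary maximal minors of a matrix and of a matrix spanning the orthogonal complement of
its row span agree up to sign and a common factor. -/
theorem exists_minor_compl_eq (hk : d + k = n) {A : Matrix (Fin d) (Fin n) ℝ}
    (hA : LinearIndependent ℝ (rowVec A)) {B : Matrix (Fin k) (Fin n) ℝ}
    (hB : rowSpan B = (rowSpan A)ᗮ) :
    ∃ c : ℝ, ∀ (I : Finset (Fin n)) (hI : I.card = d),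
      minor (Matrix.of fun i j => (-1) ^ (j : ℕ) * B i j) Iᶜ (compl_card hk hI) =
        c * minor A I hI := by
  let e : Fin d ⊕ Fin k ≃ Fin n := finSumFinEquiv.trans (finCongr hk)
  obtain ⟨s, hs⟩ := exists_sign_listingPerm e hk
  set M : Matrix (Fin d ⊕ Fin k) (Fin n) ℝ := Matrix.fromRows A B with hM
  set g := (A * A.transpose).det with hg
  have hg0 : g ≠ 0 := det_mul_transpose_self_ne_zero hA
  refine ⟨s * (M.submatrix e.symm id).det / g, fun I hI => ?_⟩
  set f := Iᶜ.orderEmbOfFin (compl_card hk hI) with hf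
  -- With the standard basis vectors of `Iᶜ` beside `Aᵀ`, the product `M * N` is block triangular
  -- with determinant `g` times a minor of `B`, while `det N` is up to sign the minor of `A` on `I`.
  -- The factor `det M` does not involve `I`.
  set N : Matrix (Fin n) (Fin d ⊕ Fin k) ℝ :=
    Matrix.fromCols A.transpose ((1 : Matrix (Fin n) (Fin n) ℝ).submatrix id f) with hN
  have h1 : (M * N).det = g * (B.submatrix id f).det := by
    have hBA : B * A.transpose = 0 := by
      ext i j
      have h2 : rowVec B i ∈ (rowSpan A)ᗮ := hB ▸ Submodule.subset_span ⟨i, rfl⟩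
      have h3 := h2 (rowVec A j) (Submodule.subset_span ⟨j, rfl⟩)
      rw [inner_eq_sum] at h3
      rw [Matrix.mul_apply, Matrix.zero_apply, ← h3]
      exact Finset.sum_congr rfl fun x _ => mul_comm _ _
    have hBf : B * (1 : Matrix (Fin n) (Fin n) ℝ).submatrix id f = B.submatrix id f := by
      have := Matrix.submatrix_mul B (1 : Matrix (Fin n) (Fin n) ℝ) id id f Function.bijective_id
      rw [Matrix.mul_one, Matrix.submatrix_id_id] at this
      exact this.symm
    rw [hM, hN, Matrix.fromRows_mul_fromCols, hBA, Matrix.det_fromBlocks_zero₂₁, hBf]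
  have h2 : (M * N).det = (M.submatrix e.symm id).det * (N.submatrix id e.symm).det := by
    rw [← Matrix.det_mul, ← Matrix.submatrix_mul M N _ _ _ Function.bijective_id,
      Matrix.det_submatrix_equiv_self]
  have h3 : ((Equiv.Perm.sign (listingPerm e hk hI) : ℤ) : ℝ) * (N.submatrix id e.symm).det =
      minor A I hI := by
    rw [← Matrix.det_permute]
    have : (N.submatrix id e.symm).submatrix (listingPerm e hk hI) id =
        (Matrix.fromBlocks (A.submatrix id (I.orderEmbOfFin hI)).transpose 0
          (A.submatrix id f).transpose 1).submatrix e.symm e.symm := by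
      ext i j
      simp only [Matrix.submatrix_apply, id, listingPerm, Equiv.trans_apply, hN]
      rcases e.symm i with x | x <;> rcases e.symm j with y | y
      · simp
      · simp only [finSumEquivOfFinset_inl, Matrix.fromCols_apply_inr, Matrix.submatrix_apply,
          Matrix.fromBlocks_apply₁₂, Matrix.zero_apply]
        refine Matrix.one_apply_ne fun h => ?_
        change I.orderEmbOfFin hI x = f y at h
        have h4 := I.orderEmbOfFin_mem hI x
        rw [h] at h4
        exact Finset.mem_compl.1 (Iᶜ.orderEmbOfFin_mem (compl_card hk hI) y) h4
      · simp [hf]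
      · simp [hf, Matrix.one_apply]
    rw [this, Matrix.det_submatrix_equiv_self, Matrix.det_fromBlocks_zero₁₂, Matrix.det_one,
      mul_one, Matrix.det_transpose, minor]
  have h4 : minor (Matrix.of fun i j => (-1) ^ (j : ℕ) * B i j) Iᶜ (compl_card hk hI) =
      (∏ j ∈ Iᶜ, (-1 : ℝ) ^ (j : ℕ)) * (B.submatrix id f).det := by
    have h5 : ∏ j ∈ Iᶜ, (-1 : ℝ) ^ (j : ℕ) = ∏ q, (-1 : ℝ) ^ (f q : ℕ) := by
      conv_lhs => rw [← Finset.map_orderEmbOfFin_univ Iᶜ (compl_card hk hI), Finset.prod_map]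
      rfl
    rw [h5, ← Matrix.det_mul_row]
    rfl
  have h6 : ((Equiv.Perm.sign (listingPerm e hk hI) : ℤ) : ℝ) *
      ((Equiv.Perm.sign (listingPerm e hk hI) : ℤ) : ℝ) = 1 := by
    rw [← Int.cast_mul, ← Units.val_mul, Int.units_mul_self]
    simp
  rw [h4, ← h3, ← hs I hI]
  have h7 : (B.submatrix id f).det = (M.submatrix e.symm id).det * (N.submatrix id e.symm).det / g := by
    rw [eq_div_iff hg0, ← h2, h1, mul_comm]
  rw [h7]
  linear_combination (-(∏ j ∈ Iᶜ, (-1 : ℝ) ^ (j : ℕ)) * (M.submatrix e.symm id).det *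
    (N.submatrix id e.symm).det / g) * h6

theorem exists_minor_eq_neg {A : Matrix (Fin d) (Fin n) ℝ} (hd : 0 < d) :
    ∃ A' : Matrix (Fin d) (Fin n) ℝ, rowSpan A' = rowSpan A ∧
      ∀ (I : Finset (Fin n)) (hI : I.card = d), minor A' I hI = -minor A I hI := by
  let i₀ : Fin d := ⟨0, hd⟩
  have hrow : ∀ A : Matrix (Fin d) (Fin n) ℝ,
      rowSpan (A.updateRow i₀ ((-1 : ℝ) • A i₀)) ≤ rowSpan A := by
    intro A
    refine Submodule.span_le.2 ?_
    rintro _ ⟨i, rfl⟩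
    by_cases h : i = i₀
    · subst h
      have : rowVec (A.updateRow i₀ ((-1 : ℝ) • A i₀)) i₀ = (-1 : ℝ) • rowVec A i₀ := by
        ext j; simp [rowVec]
      rw [this]
      exact Submodule.smul_mem _ _ (Submodule.subset_span ⟨_, rfl⟩)
    · have : rowVec (A.updateRow i₀ ((-1 : ℝ) • A i₀)) i = rowVec A i := by
        ext j; simp [rowVec, h]
      rw [this]
      exact Submodule.subset_span ⟨_, rfl⟩
  refine ⟨A.updateRow i₀ ((-1 : ℝ) • A i₀), le_antisymm (hrow A) ?_, fun I hI => ?_⟩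
  · have := hrow (A.updateRow i₀ ((-1 : ℝ) • A i₀))
    simpa using this
  · have h1 : (A.updateRow i₀ ((-1 : ℝ) • A i₀)).submatrix id (I.orderEmbOfFin hI) =
        (A.submatrix id (I.orderEmbOfFin hI)).updateRow i₀
          ((-1 : ℝ) • A.submatrix id (I.orderEmbOfFin hI) i₀) := by
      ext i j
      by_cases h : i = i₀
      · subst h; simp
      · simp [h]
    rw [minor, h1, Matrix.det_updateRow_smul, Matrix.updateRow_eq_self, neg_one_mul]
    rfl

/-- The orthogonal complement of a totally nonnegative (positive) subspace is, after alternating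
signs, totally nonnegative (positive). -/
theorem exists_dual (hk : d + k = n) {A : Matrix (Fin d) (Fin n) ℝ}
    (hA : LinearIndependent ℝ (rowVec A))
    (hpos : ∀ (I : Finset (Fin n)) (hI : I.card = d), 0 ≤ minor A I hI) :
    ∃ C : Matrix (Fin k) (Fin n) ℝ, LinearIndependent ℝ (rowVec C) ∧
      rowSpan C = (rowSpan A)ᗮ.map (altE n).toLinearMap ∧ ∃ c : ℝ, 0 < c ∧
      ∀ (I : Finset (Fin n)) (hI : I.card = d), minor C Iᶜ (compl_card hk hI) =
        c * minor A I hI := by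
  have hdim : Module.finrank ℝ (rowSpan A)ᗮ = k := by
    have h1 := (rowSpan A).finrank_add_finrank_orthogonal
    rw [finrank_rowSpan hA, finrank_euclideanSpace, Fintype.card_fin] at h1
    omega
  obtain ⟨B, hBli, hB⟩ := exists_rowSpan_eq hdim
  obtain ⟨c, hc⟩ := exists_minor_compl_eq hk hA hB
  set C : Matrix (Fin k) (Fin n) ℝ := Matrix.of fun i j => (-1) ^ (j : ℕ) * B i j with hC
  have hrow : rowVec C = altE n ∘ rowVec B := rfl
  have hCspan : rowSpan C = (rowSpan A)ᗮ.map (altE n).toLinearMap := by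
    rw [← hB, rowSpan, rowSpan, hrow, Set.range_comp, Submodule.map_span]
    rfl
  have hCli : ∀ C : Matrix (Fin k) (Fin n) ℝ,
      rowSpan C = (rowSpan A)ᗮ.map (altE n).toLinearMap → LinearIndependent ℝ (rowVec C) := by
    intro C h
    refine linearIndependent_of_finrank_rowSpan ?_
    rw [h, ← hdim]
    exact LinearEquiv.finrank_map_eq (altE n) _
  obtain ⟨J, hJ, hJ0⟩ := exists_minor_ne_zero (hCli C hCspan)
  have hJc : Jᶜ.card = d := by rw [Finset.card_compl, Fintype.card_fin, hJ]; omega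
  have hJ1 := hc Jᶜ hJc
  rw [minor_congr C (compl_compl J)] at hJ1
  rcases lt_trichotomy c 0 with h | h | h
  · rcases Nat.eq_zero_or_pos k with rfl | hk0
    · exfalso
      have h2 : minor C J hJ = 1 := Matrix.det_isEmpty
      rw [h2] at hJ1
      nlinarith [hpos Jᶜ hJc]
    · obtain ⟨C', h1, h2⟩ := exists_minor_eq_neg (A := C) hk0
      refine ⟨C', hCli C' (h1.trans hCspan), h1.trans hCspan, -c, neg_pos.2 h, fun I hI => ?_⟩
      rw [h2, hc, neg_mul]
  · rw [h, zero_mul] at hJ1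
    exact absurd hJ1 hJ0
  · exact ⟨C, hCli C hCspan, hCspan, c, h, hc⟩

end Duality

/-! ### The Gantmakher–Krein theorem -/

section GantmakherKrein

variable {d n : ℕ}

/-- Put the vector as an extra row on top of the rows it combines: the determinant on the columns
`f` vanishes, yet its Laplace expansion has terms of one sign. All entries on `f` are then zero, and
`c` annihilates an invertible submatrix. -/
theorem not_weakly_alternating {A : Matrix (Fin d) (Fin n) ℝ}
    (hA : ∀ (I : Finset (Fin n)) (hI : I.card = d), 0 < minor A I hI) {c : Fin d → ℝ} (hc : c ≠ 0)
    {f : Fin (d + 1) → Fin n} (hf : StrictMono f) {ε : ℝ} (hε : ε ≠ 0)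
    (h : ∀ i : Fin (d + 1), 0 ≤ ε * ((-1) ^ (i : ℕ) * Matrix.vecMul c A (f i))) : False := by
  have hminor : ∀ g : Fin d → Fin n, StrictMono g → 0 < (A.submatrix id g).det := fun g hg => by
    obtain ⟨I, hI, h⟩ := minor_eq_det_of_strictMono A hg
    rw [h]; exact hA I hI
  let M : Matrix (Fin (d + 1)) (Fin (d + 1)) ℝ :=
    Matrix.of (Fin.cons (fun j => Matrix.vecMul c A (f j)) fun i j => A i (f j))
  have hM : M.det = 0 := by
    refine Matrix.exists_vecMul_eq_zero_iff.1 ⟨Fin.cons 1 (-c), fun h => ?_, ?_⟩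
    · simpa using congrFun h 0
    · ext j
      simp [Matrix.vecMul, dotProduct, Fin.sum_univ_succ, M]
  rw [Matrix.det_succ_row_zero] at hM
  have hsub : ∀ j : Fin (d + 1), 0 < (M.submatrix Fin.succ j.succAbove).det := fun j => by
    have : M.submatrix Fin.succ j.succAbove = A.submatrix id (f ∘ j.succAbove) := by
      ext; simp [M]
    rw [this]
    exact hminor _ (hf.comp (Fin.strictMono_succAbove j))
  have hzero : ∀ j, Matrix.vecMul c A (f j) = 0 := by
    have h1 : ∑ j : Fin (d + 1), ε * ((-1) ^ (j : ℕ) * Matrix.vecMul c A (f j)) *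
        (M.submatrix Fin.succ j.succAbove).det = 0 := by
      rw [← mul_zero ε, ← hM, Finset.mul_sum]
      refine Finset.sum_congr rfl fun j _ => ?_
      have : M 0 j = Matrix.vecMul c A (f j) := rfl
      rw [this]; ring
    intro j
    have h2 := (Finset.sum_eq_zero_iff_of_nonneg
      fun j _ => mul_nonneg (h j) (hsub j).le).1 h1 j (Finset.mem_univ j)
    simpa [hε, (hsub j).ne'] using h2
  have h3 := hminor (f ∘ Fin.succ) (hf.comp Fin.strictMono_succ)
  refine h3.ne' (Matrix.exists_vecMul_eq_zero_iff.1 ⟨c, hc, ?_⟩)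
  ext j
  exact hzero j.succ

/-- Vectors of a totally nonnegative `d`-dimensional subspace have at most `d - 1` sign changes. -/
theorem not_le_signVar_vecMul {A : Matrix (Fin d) (Fin n) ℝ}
    (hA : ∀ (I : Finset (Fin n)) (hI : I.card = d), 0 ≤ minor A I hI)
    (hli : LinearIndependent ℝ (rowVec A)) (c : Fin d → ℝ) :
    ¬ (d : ℤ) ≤ signVar (Matrix.vecMul c A) := by
  intro h
  obtain ⟨I₀, hI₀, h₀⟩ := exists_minor_ne_zero hli
  obtain ⟨G, hG, hG0, hpos⟩ := exists_perturbation_minor_pos hA h₀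
  have hcont : Continuous fun t => Matrix.vecMul c (A * G t) := by fun_prop
  -- Having at least `d` sign changes is an open condition, so it would pass to a nearby totally
  -- positive matrix.
  have hev : ∀ᶠ t in nhds (0 : ℝ), (d : ℤ) ≤ signVar (Matrix.vecMul c (A * G t)) := by
    refine ((isOpen_le_signVar d).preimage hcont).mem_nhds ?_
    change (d : ℤ) ≤ signVar (Matrix.vecMul c (A * G 0))
    rwa [hG0, Matrix.mul_one]
  obtain ⟨t, h1, ht⟩ := ((hev.filter_mono nhdsWithin_le_nhds).and
    (self_mem_nhdsWithin (s := Set.Ioi (0 : ℝ)))).exists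
  obtain ⟨f, hf, ε, hε⟩ := le_signVar_iff.1 h1
  refine not_weakly_alternating (hpos t ht) (c := c) ?_ hf (left_ne_zero_of_mul (hε 0).ne')
    fun i => (hε i).le
  rintro rfl
  simpa using hε 0

/-- Nonzero vectors orthogonal to a totally positive `d`-dimensional subspace have at least `d`
sign changes. -/
theorem le_signVar_of_mem_orthogonal (hdn : d ≤ n) {A : Matrix (Fin d) (Fin n) ℝ}
    (hA : ∀ (I : Finset (Fin n)) (hI : I.card = d), 0 < minor A I hI) {w : E n}
    (hw : w ∈ (rowSpan A)ᗮ) (hw0 : w ≠ 0) : (d : ℤ) ≤ signVar w.ofLp := by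
  by_contra h
  have hw0' : w.ofLp ≠ 0 := fun h => hw0 (WithLp.ofLp_injective 2 h)
  -- Too few changes of `w` make its alternation weakly alternate on `n - d + 1` positions, one more
  -- than the dimension of the totally positive dual subspace containing it.
  obtain ⟨f, hf, ε, hε, hfε⟩ := exists_weakly_alternating hw0' hdn h
  obtain ⟨C, hC, hspan, c, hc, hmin⟩ := exists_dual (k := n - d) (by omega)
    (linearIndependent_of_minor_pos hdn hA) fun I hI => (hA I hI).le
  have hpos : ∀ (J : Finset (Fin n)) (hJ : J.card = n - d), 0 < minor C J hJ := by
    intro J hJ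
    have hJc : Jᶜ.card = d := by rw [Finset.card_compl, Fintype.card_fin, hJ]; omega
    have h1 := hmin Jᶜ hJc
    rw [minor_congr C (compl_compl J)] at h1
    rw [h1]
    exact mul_pos hc (hA _ _)
  have hm : altE n w ∈ rowSpan C := by
    rw [hspan]; exact Submodule.mem_map_of_mem hw
  obtain ⟨x, hx⟩ := mem_rowSpan.1 hm
  rw [altE_apply] at hx
  refine not_weakly_alternating hpos (c := x) ?_ hf hε (by rwa [← hx])
  rintro rfl
  rw [Matrix.zero_vecMul] at hx
  exact hw0' (funext fun j => altSeq_eq_zero.1 (congrFun hx j))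

end GantmakherKrein

/-! ### Continuity on Grassmannians -/

section Topology

variable {d n : ℕ}

theorem Gr.eq_of_le {V V' : Gr d n} (h : V.carrier ≤ V'.carrier) : V = V' :=
  Gr.ext (Submodule.eq_of_le_of_finrank_eq h (V.finrank_eq.trans V'.finrank_eq.symm))

/-- A map into the Grassmannian is continuous at a point if some basis of the value at this point
extends to a continuous choice of vectors of the values. -/
theorem Gr.continuousAt_of_section {T : Type*} [TopologicalSpace T] {F : T → Gr d n} {t₀ : T}
    (b : T → Fin d → E n) (hb : ContinuousAt b t₀) (hmem : ∀ t i, b t i ∈ (F t).carrier)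
    (hli : LinearIndependent ℝ (b t₀)) : ContinuousAt F t₀ := by
  have hFt : ∀ t (h : LinearIndependent ℝ (b t)),
      F t = Gr.ofMatrix ⟨fun i => (b t i).ofLp, h⟩ := fun t h => by
    refine (Gr.eq_of_le (Submodule.span_le.2 ?_)).symm
    rintro _ ⟨i, rfl⟩
    exact hmem t i
  -- Linear independence is open, so near `t₀` the section lifts `F` to full-rank matrices, where
  -- the quotient topology can be tested.
  have hev : ∀ᶠ t in nhds t₀, LinearIndependent ℝ (b t) :=
    hb.eventually (isOpen_setOfPred_linearIndependent.mem_nhds hli)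
  rw [ContinuousAt, tendsto_nhds]
  intro O hO hO₀
  obtain ⟨O', hO', heq⟩ := isOpen_induced_iff.1 (isOpen_coinduced.1 hO)
  have hB : ContinuousAt (fun t => (fun i => (b t i).ofLp : Matrix (Fin d) (Fin n) ℝ)) t₀ := by
    refine continuousAt_pi.2 fun i => ?_
    exact (PiLp.continuous_ofLp 2 _).continuousAt.comp ((continuous_apply i).continuousAt.comp hb)
  have hmem' : ∀ t (h : LinearIndependent ℝ (b t)),
      F t ∈ O ↔ (fun i => (b t i).ofLp : Matrix (Fin d) (Fin n) ℝ) ∈ O' := fun t h => by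
    rw [hFt t h]
    exact (Set.ext_iff.1 heq ⟨_, h⟩).symm
  filter_upwards [hev, hB.eventually (hO'.mem_nhds ((hmem' t₀ hli).1 hO₀))] with t h1 h2
  exact (hmem' t h1).2 h2

theorem mulVec_sub_vecMul_gram {A : Matrix (Fin d) (Fin n) ℝ}
    (hA : LinearIndependent ℝ (rowVec A)) (x : Fin n → ℝ) :
    A.mulVec (x - Matrix.vecMul ((A * A.transpose)⁻¹.mulVec (A.mulVec x)) A) = 0 := by
  have hdet : IsUnit (A * A.transpose).det := (det_mul_transpose_self_ne_zero hA).isUnit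
  rw [Matrix.mulVec_sub, ← Matrix.mulVec_transpose, Matrix.mulVec_mulVec, Matrix.mulVec_mulVec,
    Matrix.mul_nonsing_inv _ hdet, Matrix.one_mulVec, sub_self]

/-- The normal equations: `A` annihilates the residual. The explicit formula serves to show that the
projection is continuous in `A`. -/
theorem starProjection_rowSpan {A : Matrix (Fin d) (Fin n) ℝ}
    (hA : LinearIndependent ℝ (rowVec A)) (x : E n) :
    (rowSpan A).starProjection x = WithLp.toLp 2
      (Matrix.vecMul ((A * A.transpose)⁻¹.mulVec (A.mulVec x.ofLp)) A) := by
  refine Submodule.eq_starProjection_of_mem_of_inner_eq_zero (mem_rowSpan.2 ⟨_, rfl⟩) ?_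
  intro w hw
  obtain ⟨c, hc⟩ := mem_rowSpan.1 hw
  have h := mulVec_sub_vecMul_gram hA x.ofLp
  rw [inner_eq_sum]
  have h2 : ∑ j, (x - WithLp.toLp 2
      (Matrix.vecMul ((A * A.transpose)⁻¹.mulVec (A.mulVec x.ofLp)) A)) j * w j =
      dotProduct (Matrix.vecMul c A) (x.ofLp -
        Matrix.vecMul ((A * A.transpose)⁻¹.mulVec (A.mulVec x.ofLp)) A) := by
    rw [← hc]
    exact Finset.sum_congr rfl fun j _ => mul_comm _ _
  rw [h2, ← Matrix.dotProduct_mulVec, h, dotProduct_zero]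

/-- The orthogonal projection onto `V` depends continuously on `V`. -/
theorem Gr.continuous_starProjection (x : E n) :
    Continuous fun V : Gr d n => V.carrier.starProjection x := by
  refine continuous_coinduced_dom.2 ?_
  have h : (fun V : Gr d n => V.carrier.starProjection x) ∘ Gr.ofMatrix = fun A =>
      WithLp.toLp 2 (Matrix.vecMul ((A.1 * A.1.transpose)⁻¹.mulVec (A.1.mulVec x.ofLp)) A.1) :=
    funext fun A => starProjection_rowSpan A.2 x
  rw [h]
  refine (PiLp.continuous_toLp 2 _).comp ?_
  have hinv : Continuous fun A : {A : Matrix (Fin d) (Fin n) ℝ // LinearIndependent ℝ (rowVec A)} =>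
      (A.1 * A.1.transpose)⁻¹ := by
    simp only [Matrix.inv_def, Ring.inverse_eq_inv']
    refine Continuous.smul (Continuous.inv₀ ?_ fun A => det_mul_transpose_self_ne_zero A.2) ?_
    · fun_prop
    · fun_prop
  fun_prop

theorem Gr.exists_basis (V : Gr d n) :
    ∃ b : Fin d → E n, LinearIndependent ℝ b ∧ ∀ i, b i ∈ V.carrier := by
  obtain ⟨C, hC, h⟩ := exists_rowSpan_eq V.finrank_eq
  exact ⟨rowVec C, hC, fun i => h ▸ Submodule.subset_span ⟨i, rfl⟩⟩

end Topology

/-! ### The homeomorphism `f_Z` and its inverse -/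

section Twist

variable {n k m : ℕ} {Z : Matrix (Fin (k + m)) (Fin n) ℝ}

theorem inner_toEuclideanLin_transpose {p : ℕ} (Z : Matrix (Fin p) (Fin n) ℝ) (u : E p) (x : E n) :
    inner ℝ (Z.transpose.toEuclideanLin u) x = inner ℝ u (Z.toEuclideanLin x) := by
  rw [inner_eq_sum, inner_eq_sum]
  have h := Matrix.dotProduct_mulVec u.ofLp Z x.ofLp
  rw [← Matrix.mulVec_transpose] at h
  exact h.symm

theorem ofLp_toEuclideanLin_transpose {p : ℕ} (Z : Matrix (Fin p) (Fin n) ℝ) (u : E p) :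
    (Z.transpose.toEuclideanLin u).ofLp = Matrix.vecMul u.ofLp Z :=
  Matrix.mulVec_transpose Z u.ofLp

theorem range_toEuclideanLin_transpose {p : ℕ} (Z : Matrix (Fin p) (Fin n) ℝ) :
    LinearMap.range Z.transpose.toEuclideanLin = rowSpan Z := by
  ext x
  rw [mem_rowSpan, LinearMap.mem_range]
  constructor
  · rintro ⟨u, rfl⟩
    exact ⟨u.ofLp, ofLp_toEuclideanLin_transpose Z u⟩
  · rintro ⟨c, hc⟩
    exact ⟨WithLp.toLp 2 c, WithLp.ofLp_injective 2 (by rw [ofLp_toEuclideanLin_transpose, hc])⟩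

theorem toEuclideanLin_transpose_injective {p : ℕ} {Z : Matrix (Fin p) (Fin n) ℝ}
    (hZ : LinearIndependent ℝ (rowVec Z)) : Function.Injective Z.transpose.toEuclideanLin := by
  intro u u' h
  refine WithLp.ofLp_injective 2 (vecMul_injective hZ ?_)
  change Matrix.vecMul u.ofLp Z = Matrix.vecMul u'.ofLp Z
  rw [← ofLp_toEuclideanLin_transpose, ← ofLp_toEuclideanLin_transpose, h]

theorem finrank_map_orthogonal_transpose (hZ : LinearIndependent ℝ (rowVec Z))
    (Y : Gr k (k + m)) :
    Module.finrank ℝ (Y.carrierᗮ.map Z.transpose.toEuclideanLin) = m := by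
  rw [← (Submodule.equivMapOfInjective _ (toEuclideanLin_transpose_injective hZ) _).finrank_eq]
  have h := Y.carrier.finrank_add_finrank_orthogonal
  rw [Y.finrank_eq, finrank_euclideanSpace, Fintype.card_fin] at h
  exact Nat.add_left_cancel h

/-- The inverse `Y ↦ Zᵀ(Y^⊥)` of `f_Z`. -/
def fZInv (Z : Matrix (Fin (k + m)) (Fin n) ℝ) (hZ : LinearIndependent ℝ (rowVec Z))
    (Y : Gr k (k + m)) : GrIn m (rowSpan Z) :=
  ⟨⟨Y.carrierᗮ.map Z.transpose.toEuclideanLin, finrank_map_orthogonal_transpose hZ Y⟩, by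
    rw [← range_toEuclideanLin_transpose]
    exact LinearMap.map_le_range⟩

theorem mem_fZInv_iff {hZ : LinearIndependent ℝ (rowVec Z)} {Y : Gr k (k + m)} {x : E n} :
    x ∈ (fZInv Z hZ Y).1.carrier ↔ ∃ u ∈ Y.carrierᗮ, Z.transpose.toEuclideanLin u = x :=
  Submodule.mem_map

theorem fZ_fZInv (hZ : LinearIndependent ℝ (rowVec Z)) (Y : Gr k (k + m)) :
    fZ Z hZ (fZInv Z hZ Y) = Y := by
  refine Gr.eq_of_le ?_
  rintro _ ⟨x, hx, rfl⟩
  rw [← Submodule.orthogonal_orthogonal Y.carrier]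
  intro u hu
  rw [← inner_toEuclideanLin_transpose]
  exact hx _ (Submodule.mem_map_of_mem hu)

theorem fZInv_fZ (hZ : LinearIndependent ℝ (rowVec Z)) (X : GrIn m (rowSpan Z)) :
    fZInv Z hZ (fZ Z hZ X) = X := by
  refine Subtype.ext (Gr.eq_of_le ?_)
  rintro _ ⟨u, hu, rfl⟩
  rw [← Submodule.orthogonal_orthogonal X.1.carrier]
  intro x hx
  rw [real_inner_comm, inner_toEuclideanLin_transpose, real_inner_comm]
  exact hu _ (Submodule.mem_map_of_mem hx)

theorem continuous_fZ (hZ : LinearIndependent ℝ (rowVec Z)) : Continuous (fZ Z hZ) := by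
  refine continuous_iff_continuousAt.2 fun X₀ => ?_
  obtain ⟨y, hy, hmem⟩ := (fZ Z hZ X₀).exists_basis
  choose x hx hxy using hmem
  -- Fixed preimages `x i` of a basis at `X₀` are projected to `X^⊥` before applying `Z`; at `X₀`
  -- the projection leaves them unchanged.
  refine Gr.continuousAt_of_section
    (fun X i => Z.toEuclideanLin (x i - X.1.carrier.starProjection (x i))) ?_ (fun X i => ?_) ?_
  · refine Continuous.continuousAt (continuous_pi fun i => ?_)
    refine (LinearMap.continuous_of_finiteDimensional _).comp (continuous_const.sub ?_)
    exact (Gr.continuous_starProjection (x i)).comp continuous_subtype_val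
  · exact Submodule.mem_map_of_mem (Submodule.sub_starProjection_mem_orthogonal _)
  · have : (fun i => Z.toEuclideanLin (x i - X₀.1.carrier.starProjection (x i))) = y := by
      funext i
      rw [(Submodule.starProjection_apply_eq_zero_iff _).2 (hx i), sub_zero, hxy]
    rw [this]
    exact hy

theorem continuous_fZInv (hZ : LinearIndependent ℝ (rowVec Z)) : Continuous (fZInv Z hZ) := by
  refine continuous_induced_rng.2 (continuous_iff_continuousAt.2 fun Y₀ => ?_)
  obtain ⟨y, hy, hmem⟩ := (fZInv Z hZ Y₀).1.exists_basis
  choose u hu huy using hmem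
  refine Gr.continuousAt_of_section
    (fun Y i => Z.transpose.toEuclideanLin (u i - Y.carrier.starProjection (u i))) ?_
    (fun Y i => ?_) ?_
  · refine Continuous.continuousAt (continuous_pi fun i => ?_)
    exact (LinearMap.continuous_of_finiteDimensional _).comp
      (continuous_const.sub (Gr.continuous_starProjection (u i)))
  · exact Submodule.mem_map_of_mem (Submodule.sub_starProjection_mem_orthogonal _)
  · have : (fun i => Z.transpose.toEuclideanLin (u i - Y₀.carrier.starProjection (u i))) = y := by
      funext i
      rw [(Submodule.starProjection_apply_eq_zero_iff _).2 (hu i), sub_zero, huy]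
    rw [this]
    exact hy

/-- `f_Z` is a homeomorphism. -/
def fZHomeomorph (hZ : LinearIndependent ℝ (rowVec Z)) :
    GrIn m (rowSpan Z) ≃ₜ Gr k (k + m) where
  toFun := fZ Z hZ
  invFun := fZInv Z hZ
  left_inv := fZInv_fZ hZ
  right_inv := fZ_fZInv hZ
  continuous_toFun := continuous_fZ hZ
  continuous_invFun := continuous_fZInv hZ

end Twist

/-! ### Open and closed conditions on sign variation -/

section Variation

variable {n m : ℕ}

/-- A lower bound on var is open for each vector. Scaling reduces to coefficient vectors on the unit
sphere, whose compactness gives a uniform neighbourhood. -/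
theorem isOpen_setOf_forall_le_signVar (k : ℕ) : IsOpen {X : Gr m n |
    ∀ v ∈ X.carrier, v ≠ 0 → (k : ℤ) ≤ signVar v.ofLp} := by
  refine isOpen_coinduced.2 ?_
  have key : IsOpen {A : Matrix (Fin m) (Fin n) ℝ | ∀ c ∈ Metric.sphere (0 : Fin m → ℝ) 1,
      (k : ℤ) ≤ signVar (Matrix.vecMul c A)} := by
    refine isOpen_iff_mem_nhds.2 fun A hA => ?_
    refine (isCompact_sphere (0 : Fin m → ℝ) 1).eventually_forall_of_forall_eventually
      fun c hc => ?_
    have hcont : Continuous fun p : Matrix (Fin m) (Fin n) ℝ × (Fin m → ℝ) =>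
      Matrix.vecMul p.2 p.1 := by fun_prop
    exact ((isOpen_le_signVar k).preimage hcont).mem_nhds (hA c hc)
  convert key.preimage continuous_subtype_val using 1
  ext ⟨A, hA⟩
  constructor
  · intro h c hc
    refine h (WithLp.toLp 2 (Matrix.vecMul c A)) (mem_rowSpan.2 ⟨c, rfl⟩) fun h0 => ?_
    have : c = 0 := vecMul_injective hA (by simpa using congrArg WithLp.ofLp h0)
    simp [this] at hc
  · intro h v hv hv0
    obtain ⟨c, hc⟩ := mem_rowSpan.1 hv
    have hc0 : c ≠ 0 := by
      rintro rfl
      rw [Matrix.zero_vecMul] at hc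
      exact hv0 (WithLp.ofLp_injective 2 hc)
    have hn : ‖c‖ ≠ 0 := norm_ne_zero_iff.2 hc0
    have h1 : (k : ℤ) ≤ signVar (Matrix.vecMul (‖c‖⁻¹ • c) A) :=
      h (‖c‖⁻¹ • c) (by simp [norm_smul, hn])
    rw [Matrix.smul_vecMul, ← hc] at h1
    exact (le_signVar_smul_iff (inv_ne_zero hn)).1 h1

/-- An upper bound on var is closed for each fixed coefficient vector, so an arbitrary intersection
suffices and no compactness is needed. -/
theorem isClosed_setOf_forall_signVar_altSeq (r : ℕ) : IsClosed {X : Gr m n |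
    ∀ v ∈ X.carrier, ¬ (r : ℤ) ≤ signVar (altSeq v.ofLp)} := by
  refine isClosed_coinduced.2 ?_
  have key : IsClosed {A : Matrix (Fin m) (Fin n) ℝ | ∀ c : Fin m → ℝ,
      ¬ (r : ℤ) ≤ signVar (altSeq (Matrix.vecMul c A))} := by
    rw [Set.ofPred_forall]
    refine isClosed_iInter fun c => ?_
    have hcont : Continuous fun A : Matrix (Fin m) (Fin n) ℝ => altSeq (Matrix.vecMul c A) := by
      refine continuous_pi fun j => ?_
      simp only [altSeq]
      fun_prop
    exact ((isOpen_le_signVar r).preimage hcont).isClosed_compl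
  convert key.preimage continuous_subtype_val using 1
  ext ⟨A, hA⟩
  constructor
  · intro h c
    exact h (WithLp.toLp 2 (Matrix.vecMul c A)) (mem_rowSpan.2 ⟨c, rfl⟩)
  · intro h v hv
    obtain ⟨c, hc⟩ := mem_rowSpan.1 hv
    rw [hc]
    exact h c

end Variation

/-! ### Elementary vectors and reduction to m - 1 zeros -/

section Elementary

variable {n m k : ℕ}

/-- Every nonzero vector of `X` dominates, in sign pattern, an elementary vector of `X`. -/
theorem exists_conformal_elementary (X : Submodule ℝ (E n)) {v : E n} (hv : v ∈ X) (hv0 : v ≠ 0) :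
    ∃ w ∈ X, w ≠ 0 ∧ (∀ i, w i ≠ 0 → 0 < w i * v i) ∧
      ∀ u ∈ X, (∀ i, w i = 0 → u i = 0) → ∃ c : ℝ, u = c • w := by
  classical
  let supp : E n → Finset (Fin n) := fun w => Finset.univ.filter fun i => w i ≠ 0
  let S : Set (E n) := {w | w ∈ X ∧ w ≠ 0 ∧ ∀ i, w i ≠ 0 → 0 < w i * v i}
  have hvS : v ∈ S := ⟨hv, hv0, fun i hi => mul_self_pos.2 hi⟩
  -- Minimal support is taken only among vectors conformal to `v`; `hzero` shows that it is then
  -- minimal among all nonzero vectors of `X`.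
  obtain ⟨w, ⟨hwX, hw0, hwv⟩, hmin⟩ :=
    (measure fun w : E n => (supp w).card).wf.has_min S ⟨v, hvS⟩
  have hmin' : ∀ u ∈ S, (supp w).card ≤ (supp u).card := fun u hu => not_lt.1 (hmin u hu)
  have hzero : ∀ u ∈ X, (∀ i, w i = 0 → u i = 0) → (∃ j, w j ≠ 0 ∧ u j = 0) → u = 0 := by
    suffices h : ∀ u ∈ X, (∀ i, w i = 0 → u i = 0) → (∃ j, w j ≠ 0 ∧ u j = 0) →
        ¬ ∃ i, 0 < u i * w i by
      intro u hu huw hj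
      by_contra hu0
      obtain ⟨i, hi⟩ : ∃ i, u i ≠ 0 := by
        by_contra! h0
        exact hu0 (by ext i; exact h0 i)
      have hwi : w i ≠ 0 := fun h0 => hi (huw i h0)
      rcases lt_or_gt_of_ne (mul_ne_zero hi hwi) with h1 | h1
      · refine h (-u) (X.neg_mem hu) (fun i h0 => by simp [huw i h0]) ?_ ⟨i, by simpa using h1⟩
        obtain ⟨j, h2, h3⟩ := hj
        exact ⟨j, h2, by simp [h3]⟩
      · exact h u hu huw hj ⟨i, h1⟩
    rintro u hu huw ⟨j, hwj, huj⟩ ⟨i, hi⟩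
    -- The least ratio is the first time at which `w - t • u` loses a coordinate, before any
    -- coordinate changes sign; entry `j` keeps the result nonzero.
    obtain ⟨p, hp, hpmin⟩ := (Finset.univ.filter fun i => 0 < u i * w i).exists_min_image
      (fun i => w i / u i) ⟨i, by simpa using hi⟩
    simp only [Finset.mem_filter, Finset.mem_univ, true_and] at hp hpmin
    have hup : u p ≠ 0 := left_ne_zero_of_mul hp.ne'
    have hwp : w p ≠ 0 := right_ne_zero_of_mul hp.ne'
    set t := w p / u p with ht
    have ht0 : 0 < t := by
      have : t = (u p * w p) / (u p) ^ 2 := by rw [ht]; field_simp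
      rw [this]
      positivity
    have hsame : ∀ i, 0 ≤ (w - t • u) i * w i ∧ (w i = 0 → (w - t • u) i = 0) := by
      intro i
      simp only [PiLp.sub_apply, PiLp.smul_apply, smul_eq_mul]
      refine ⟨?_, fun h0 => by rw [h0, huw i h0]; ring⟩
      rcases le_or_gt (u i * w i) 0 with h1 | h1
      · nlinarith [mul_self_nonneg (w i), mul_nonneg ht0.le (neg_nonneg.2 h1)]
      · have h2 := hpmin i h1
        have h3 : u i ≠ 0 := left_ne_zero_of_mul h1.ne'
        have h4 : (w i - t * u i) * w i = (w i / u i - t) * (u i * w i) := by field_simp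
        rw [h4]
        exact mul_nonneg (sub_nonneg.2 h2) h1.le
    have hmem : w - t • u ∈ S := by
      refine ⟨X.sub_mem hwX (X.smul_mem t hu), fun h0 => ?_, fun i hi => ?_⟩
      · have h1 : (w - t • u) j = 0 := by rw [h0]; rfl
        simp [huj, hwj] at h1
      · have hwi : w i ≠ 0 := fun h0 => hi ((hsame i).2 h0)
        have h1 : 0 < (w - t • u) i * w i :=
          lt_of_le_of_ne (hsame i).1 (mul_ne_zero hi hwi).symm
        have h2 := mul_pos h1 (hwv i hwi)
        have h3 : (w - t • u) i * w i * (w i * v i) = (w i) ^ 2 * ((w - t • u) i * v i) := by ring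
        rw [h3] at h2
        exact (pos_iff_pos_of_mul_pos h2).1 (by positivity)
    refine not_lt_of_ge (hmin' _ hmem) (Finset.card_lt_card ?_)
    refine (Finset.ssubset_iff_of_subset fun i hi => ?_).2 ⟨p, by simpa [supp] using hwp, ?_⟩
    · simp only [supp, Finset.mem_filter, Finset.mem_univ, true_and] at hi ⊢
      exact fun h0 => hi ((hsame i).2 h0)
    · have h0 : (w - t • u) p = 0 := by
        rw [PiLp.sub_apply, PiLp.smul_apply, smul_eq_mul, ht, div_mul_cancel₀ _ hup, sub_self]
      exact fun h => (Finset.mem_filter.1 h).2 h0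
  refine ⟨w, hwX, hw0, hwv, fun u hu huw => ?_⟩
  obtain ⟨i, hi⟩ : ∃ i, w i ≠ 0 := by
    by_contra! h0
    exact hw0 (by ext i; exact h0 i)
  refine ⟨u i / w i, sub_eq_zero.1 (hzero _ (X.sub_mem hu (X.smul_mem _ hwX)) ?_ ⟨i, hi, ?_⟩)⟩
  · intro l hl
    simp [hl, huw l hl]
  · simp [hi]

/-- The coordinate functional `x ↦ x_i` on a subspace. -/
def coordOn (X : Submodule ℝ (E n)) (i : Fin n) : Module.Dual ℝ X :=
  (EuclideanSpace.proj i : E n →L[ℝ] ℝ).toLinearMap ∘ₗ X.subtype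

theorem coordOn_apply (X : Submodule ℝ (E n)) (i : Fin n) (x : X) :
    coordOn X i x = (x : E n) i := rfl

/-- An elementary vector of an `m`-dimensional subspace is determined, up to scaling, by `m - 1` of
its zeros. -/
theorem exists_card_add_one_eq {X : Submodule ℝ (E n)} (hX : Module.finrank ℝ X = m) {w : E n}
    (hwX : w ∈ X) (hw0 : w ≠ 0)
    (hel : ∀ u ∈ X, (∀ i, w i = 0 → u i = 0) → ∃ c : ℝ, u = c • w) :
    ∃ I : Finset (Fin n), I.card + 1 = m ∧ (∀ i ∈ I, w i = 0) ∧
      ∀ u ∈ X, (∀ i ∈ I, u i = 0) → ∃ c : ℝ, u = c • w := by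
  classical
  set s : Set (Module.Dual ℝ X) := coordOn X '' {i | w i = 0} with hs
  set Φ := Submodule.span ℝ s with hΦ
  -- The coordinate functionals vanishing at `w` cut out exactly the line of `w`, so they span
  -- dimension `m - 1`; a basis chosen among them gives `I`.
  have hann : Φ.dualCoannihilator = Submodule.span ℝ {(⟨w, hwX⟩ : X)} := by
    ext u
    rw [Submodule.mem_dualCoannihilator, Submodule.mem_span_singleton]
    constructor
    · intro h
      obtain ⟨c, hc⟩ := hel u u.2 fun i hi => h _ (Submodule.subset_span ⟨i, hi, rfl⟩)
      exact ⟨c, Subtype.ext hc.symm⟩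
    · rintro ⟨c, rfl⟩ φ hφ
      induction hφ using Submodule.span_induction with
      | mem φ hφ =>
        obtain ⟨i, hi, rfl⟩ := hφ
        have hi' : w i = 0 := hi
        simp [coordOn_apply, hi']
      | zero => simp
      | add φ ψ _ _ h1 h2 => rw [LinearMap.add_apply, h1, h2, add_zero]
      | smul a φ _ h1 => rw [LinearMap.smul_apply, h1, smul_zero]
  have hdim : Module.finrank ℝ Φ + 1 = m := by
    have h1 := Subspace.finrank_add_finrank_dualCoannihilator_eq Φ
    have h2 : (⟨w, hwX⟩ : X) ≠ 0 := fun h => hw0 (congrArg Subtype.val h)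
    rw [hann, finrank_span_singleton h2, hX] at h1
    exact h1
  obtain ⟨f, hf, hspan, hli⟩ := Submodule.exists_fun_fin_finrank_span_eq ℝ s
  choose g hg0 hg using hf
  have hginj : Function.Injective g := fun i j h => hli.injective (by rw [← hg, ← hg, h])
  refine ⟨Finset.univ.image g, ?_, ?_, fun u hu hui => ?_⟩
  · rw [Finset.card_image_of_injective _ hginj, Finset.card_fin, ← hdim]
  · intro i hi
    obtain ⟨a, -, rfl⟩ := Finset.mem_image.1 hi
    exact hg0 a
  · refine hel u hu fun i hi => ?_
    have h1 : coordOn X i ∈ Submodule.span ℝ (Set.range f) := by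
      rw [hspan]; exact Submodule.subset_span ⟨i, hi, rfl⟩
    have h2 : ∀ φ ∈ Submodule.span ℝ (Set.range f), φ ⟨u, hu⟩ = 0 := by
      intro φ hφ
      induction hφ using Submodule.span_induction with
      | mem φ hφ =>
        obtain ⟨a, rfl⟩ := hφ
        rw [← hg]
        exact hui _ (Finset.mem_image_of_mem _ (Finset.mem_univ a))
      | zero => simp
      | add φ ψ _ _ h1 h2 => rw [LinearMap.add_apply, h1, h2, add_zero]
      | smul a φ _ h1 => rw [LinearMap.smul_apply, h1, smul_zero]
    exact h2 _ h1

/-- A lower bound on the sign variation of the nonzero vectors of an `m`-dimensional subspace may be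
checked on vectors vanishing on `m - 1` positions. -/
theorem forall_le_signVar_iff {X : Submodule ℝ (E n)} (hX : Module.finrank ℝ X = m)
    (x : ∀ I : Finset (Fin n), I.card + 1 = m → E n) (hx : ∀ I hI, x I hI ∈ X)
    (hxI : ∀ I hI, ∀ i ∈ I, x I hI i = 0)
    (hne : ∀ I hI, ∀ w ∈ X, w ≠ 0 →
      (∀ u ∈ X, (∀ i ∈ I, u i = 0) → ∃ c : ℝ, u = c • w) → x I hI ≠ 0) :
    (∀ v ∈ X, v ≠ 0 → (k : ℤ) ≤ signVar v.ofLp) ↔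
      ∀ I hI, (fun j : {j // j ∉ I} => x I hI j) ≠ 0 →
        (k : ℤ) ≤ signVar fun j : {j // j ∉ I} => x I hI j := by
  constructor
  · intro h I hI h0
    rw [le_signVar_restrict_iff (hxI I hI)]
    refine h _ (hx I hI) fun h1 => h0 ?_
    rw [h1]
    rfl
  · intro h v hv hv0
    obtain ⟨w, hwX, hw0, hwv, hel⟩ := exists_conformal_elementary X hv hv0
    obtain ⟨I, hI, hwI, huniq⟩ := exists_card_add_one_eq hX hwX hw0 hel
    -- The candidate vector for `I` may vanish in general, but not when the vectors of `X` vanishing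
    -- on `I` form a line; it is then a nonzero multiple of `w`.
    have hxne := hne I hI w hwX hw0 huniq
    obtain ⟨c, hc⟩ := huniq _ (hx I hI) (hxI I hI)
    have hc0 : c ≠ 0 := by
      rintro rfl
      exact hxne (by rw [hc, zero_smul])
    have h1 : (fun j : {j // j ∉ I} => x I hI j) ≠ 0 := by
      intro h1
      refine hxne ?_
      ext j
      by_cases hj : j ∈ I
      · exact hxI I hI j hj
      · exact congrFun h1 ⟨j, hj⟩
    have h2 := (le_signVar_restrict_iff (hxI I hI)).1 (h I hI h1)
    rw [hc] at h2
    exact le_signVar_of_conformal (g := id) strictMono_id hwv ((le_signVar_smul_iff hc0).1 h2)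

end Elementary

/-! ### Determinantal criteria for 𝒢 and ℱ -/

section Criteria

variable {n m k : ℕ}

/-- The determinant of `[A_j | A_{i_1} | ⋯ | A_{i_{m-1}}]`, as a function of `j`. -/
def consDet (A : Matrix (Fin m) (Fin n) ℝ) (I : Finset (Fin n)) (hI : I.card + 1 = m) (j : Fin n) :
    ℝ :=
  (A.submatrix id fun c => (Fin.cons j (I.orderEmbOfFin rfl) : Fin (I.card + 1) → Fin n)
    (Fin.cast hI.symm c)).det

/-- The coefficients `u` are the cofactors of the first column. The sign `(-1)^{|I ∩ [j]|}` comes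
from moving column `j` to its sorted place `p`, as `p = |I ∩ [j]|` counting from zero. -/
theorem exists_consDet_eq_vecMul (A : Matrix (Fin m) (Fin n) ℝ) (I : Finset (Fin n))
    (hI : I.card + 1 = m) :
    ∃ u : Fin m → ℝ, Matrix.vecMul u A = consDet A I hI ∧ ∀ j : {j // j ∉ I},
      Matrix.vecMul u A j = pluckerSeq A I hI j := by
  subst hI
  refine ⟨fun i => (-1) ^ (i : ℕ) * (A.submatrix i.succAbove (I.orderEmbOfFin rfl)).det, ?_, ?_⟩
  · ext j
    rw [consDet, Matrix.det_succ_column_zero, Matrix.vecMul, dotProduct]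
    refine Finset.sum_congr rfl fun i _ => ?_
    have h1 : (A.submatrix id fun c => (Fin.cons j (I.orderEmbOfFin rfl) : Fin (I.card + 1) → Fin n)
        (Fin.cast rfl c)).submatrix i.succAbove Fin.succ =
        A.submatrix i.succAbove (I.orderEmbOfFin rfl) := by
      ext a b; simp
    rw [h1]
    simp
    ring
  · rintro ⟨j, hj⟩
    have hc : (insert j I).card = I.card + 1 := Finset.card_insert_of_notMem hj
    obtain ⟨p, hp⟩ : j ∈ Set.range ((insert j I).orderEmbOfFin hc) := by
      rw [Finset.range_orderEmbOfFin]; simp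
    have hsub : (insert j I).orderEmbOfFin hc ∘ p.succAbove = I.orderEmbOfFin rfl := by
      refine Finset.orderEmbOfFin_unique rfl (fun q => ?_)
        (((insert j I).orderEmbOfFin hc).strictMono.comp (Fin.strictMono_succAbove p))
      refine Finset.mem_of_mem_insert_of_ne ((insert j I).orderEmbOfFin_mem hc _) fun h => ?_
      exact Fin.succAbove_ne p q (((insert j I).orderEmbOfFin hc).injective (h.trans hp.symm))
    have hcard : (I.filter fun i => i ≤ j).card = p := by
      rw [← card_filter_lt_orderEmbOfFin hc p, hp]
      congr 1
      ext i
      simp only [Finset.mem_filter, Finset.mem_insert]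
      constructor
      · rintro ⟨h1, h2⟩
        exact ⟨Or.inr h1, lt_of_le_of_ne h2 fun h => hj (h ▸ h1)⟩
      · rintro ⟨rfl | h1, h2⟩
        exacts [absurd h2 (lt_irrefl _), ⟨h1, h2.le⟩]
    rw [pluckerSeq, hcard, minor, Matrix.det_succ_column _ p, Finset.mul_sum, Matrix.vecMul,
      dotProduct]
    refine Finset.sum_congr rfl fun i _ => ?_
    rw [Matrix.submatrix_submatrix, Matrix.submatrix_apply, hp, hsub, pow_add]
    have h3 : ((-1 : ℝ) ^ (p : ℕ)) * ((-1) ^ (p : ℕ)) = 1 := by rw [← mul_pow]; simp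
    simp only [id, Function.id_comp]
    linear_combination (-((-1 : ℝ) ^ (i : ℕ) * A i j *
      (A.submatrix i.succAbove (I.orderEmbOfFin rfl)).det)) * h3

/-- The description of `𝒢` by Plücker coordinates. -/
theorem forall_le_signVar_iff_pluckerSeq {X : Submodule ℝ (E n)} (hX : Module.finrank ℝ X = m)
    {A : Matrix (Fin m) (Fin n) ℝ} (hA : rowSpan A = X) :
    (∀ v ∈ X, v ≠ 0 → (k : ℤ) ≤ signVar v.ofLp) ↔
      ∀ (I : Finset (Fin n)) (hI : I.card + 1 = m), pluckerSeq A I hI ≠ 0 →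
        (k : ℤ) ≤ signVar (pluckerSeq A I hI) := by
  have hli : LinearIndependent ℝ (rowVec A) :=
    linearIndependent_of_finrank_rowSpan (by rw [hA, hX])
  have key := forall_le_signVar_iff (k := k) hX (fun I hI => WithLp.toLp 2 (consDet A I hI)) ?_ ?_ ?_
  · rw [key]
    refine forall_congr' fun I => forall_congr' fun hI => ?_
    have : (fun j : {j // j ∉ I} => WithLp.toLp 2 (consDet A I hI) j) = pluckerSeq A I hI := by
      obtain ⟨u, h1, h2⟩ := exists_consDet_eq_vecMul A I hI
      funext j
      rw [← h2, h1]
    rw [this]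
  · intro I hI
    obtain ⟨u, h1, -⟩ := exists_consDet_eq_vecMul A I hI
    rw [← hA]
    exact mem_rowSpan.2 ⟨u, h1.symm⟩
  · rintro I rfl i hi
    obtain ⟨q, hq⟩ : i ∈ Set.range (I.orderEmbOfFin rfl) := by
      rw [Finset.range_orderEmbOfFin]; exact hi
    refine Matrix.det_zero_of_column_eq (i := 0) (j := q.succ) (Fin.succ_ne_zero q).symm fun r => ?_
    simp [hq]
  · rintro I hI w hw hw0 huniq h0
    obtain ⟨j, hj⟩ : ∃ i, w i ≠ 0 := by
      by_contra! h0
      exact hw0 (by ext i; exact h0 i)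
    have h1 : consDet A I hI j = 0 := congrArg (fun x : E n => x j) h0
    -- A left kernel vector yields an element of `X` vanishing on `I` and at `j`. It is a multiple
    -- of `w` with `w j ≠ 0`, hence zero, contradicting independence of the rows.
    obtain ⟨c, hc0, hc⟩ := Matrix.exists_vecMul_eq_zero_iff.2 h1
    subst hI
    obtain ⟨t, ht⟩ := huniq (WithLp.toLp 2 (Matrix.vecMul c A)) (hA ▸ mem_rowSpan.2 ⟨c, rfl⟩)
      fun i hi => by
        obtain ⟨q, hq⟩ : i ∈ Set.range (I.orderEmbOfFin rfl) := by
          rw [Finset.range_orderEmbOfFin]; exact hi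
        have := congrFun hc q.succ
        rw [← hq]
        simpa [Matrix.vecMul, dotProduct] using this
    have h2 : Matrix.vecMul c A j = 0 := by
      have := congrFun hc 0
      simpa [Matrix.vecMul, dotProduct] using this
    have h3 : t * w j = 0 := by rw [← h2]; exact (congrArg (fun x : E n => x j) ht).symm
    have ht0 : t = 0 := (mul_eq_zero.1 h3).resolve_right hj
    rw [ht0, zero_smul] at ht
    exact hc0 (vecMul_injective hli (by simpa using congrArg WithLp.ofLp ht))

/-- The matrix `[y₁ | ⋯ | y_k | z_{i₁} | ⋯ | z_{i_{m-1}} | x]`. -/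
def detMatrix (Z : Matrix (Fin (k + m)) (Fin n) ℝ) (y : Fin k → E (k + m))
    (I : Finset (Fin n)) (hI : I.card + 1 = m) (x : Fin (k + m) → ℝ) :
    Matrix (Fin (k + m)) (Fin (k + m)) ℝ :=
  Matrix.of fun r c => Fin.append (fun a : Fin k => y a r)
    (fun b : Fin m => (Fin.snoc (fun q => Z r (I.orderEmbOfFin rfl q)) (x r) :
      Fin (I.card + 1) → ℝ) (Fin.cast hI.symm b)) c

theorem detSeq_eq (Z : Matrix (Fin (k + m)) (Fin n) ℝ) (y : Fin k → E (k + m))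
    (I : Finset (Fin n)) (hI : I.card + 1 = m) (j : {j // j ∉ I}) :
    detSeq Z y I hI j = (detMatrix Z y I hI fun r => Z r j).det := by
  subst hI
  rw [detSeq, detMatrix]
  congr 1
  ext r c
  refine Fin.addCases (fun a => ?_) (fun b => ?_) c
  · simp
  · rw [Matrix.of_apply, Matrix.of_apply, Fin.append_right, Fin.append_right]
    refine Fin.lastCases ?_ (fun q => ?_) b <;> simp

theorem detMatrix_castAdd (Z : Matrix (Fin (k + m)) (Fin n) ℝ) (y : Fin k → E (k + m))
    (I : Finset (Fin n)) (hI : I.card + 1 = m) (x : Fin (k + m) → ℝ) (r : Fin (k + m))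
    (a : Fin k) : detMatrix Z y I hI x r (Fin.castAdd m a) = y a r := by
  simp [detMatrix]

theorem detMatrix_natAdd_castSucc (I : Finset (Fin n)) (Z : Matrix (Fin (k + (I.card + 1))) (Fin n) ℝ)
    (y : Fin k → E (k + (I.card + 1))) (x : Fin (k + (I.card + 1)) → ℝ)
    (r : Fin (k + (I.card + 1))) (q : Fin I.card) :
    detMatrix Z y I rfl x r (Fin.natAdd k q.castSucc) = Z r (I.orderEmbOfFin rfl q) := by
  simp [detMatrix]

theorem detMatrix_natAdd_last (I : Finset (Fin n)) (Z : Matrix (Fin (k + (I.card + 1))) (Fin n) ℝ)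
    (y : Fin k → E (k + (I.card + 1))) (x : Fin (k + (I.card + 1)) → ℝ)
    (r : Fin (k + (I.card + 1))) :
    detMatrix Z y I rfl x r (Fin.natAdd k (Fin.last _)) = x r := by
  rw [detMatrix, Matrix.of_apply, Fin.append_right, Fin.cast_refl, id, Fin.snoc_last]

theorem det_detMatrix (I : Finset (Fin n)) (Z : Matrix (Fin (k + (I.card + 1))) (Fin n) ℝ)
    (y : Fin k → E (k + (I.card + 1))) (x : Fin (k + (I.card + 1)) → ℝ) :
    (detMatrix Z y I rfl x).det =
      Matrix.cramer (detMatrix Z y I rfl 0) x (Fin.natAdd k (Fin.last _)) := by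
  rw [Matrix.cramer_apply]
  congr 1
  ext r c
  refine Fin.addCases (fun a => ?_) (fun b => ?_) c
  · rw [detMatrix_castAdd, Matrix.updateCol_ne, detMatrix_castAdd]
    simp [Fin.ext_iff]; omega
  · refine Fin.lastCases ?_ (fun q => ?_) b
    · rw [detMatrix_natAdd_last, Matrix.updateCol_self]
    · rw [detMatrix_natAdd_castSucc, Matrix.updateCol_ne, detMatrix_natAdd_castSucc]
      simp [Fin.ext_iff]; omega

theorem exists_det_detMatrix_eq (Z : Matrix (Fin (k + m)) (Fin n) ℝ) (y : Fin k → E (k + m))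
    (I : Finset (Fin n)) (hI : I.card + 1 = m) :
    ∃ u : Fin (k + m) → ℝ, ∀ x, (detMatrix Z y I hI x).det = dotProduct u x := by
  subst hI
  set L : (Fin (k + (I.card + 1)) → ℝ) →ₗ[ℝ] ℝ := LinearMap.proj (Fin.natAdd k (Fin.last _)) ∘ₗ
    Matrix.cramer (detMatrix Z y I rfl 0) with hL
  refine ⟨fun r => L (Pi.single r 1), fun x => ?_⟩
  rw [det_detMatrix, dotProduct]
  change L x = _
  conv_lhs => rw [LinearMap.pi_apply_eq_sum_univ L x]
  refine Finset.sum_congr rfl fun r _ => ?_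
  rw [smul_eq_mul, mul_comm]
  congr 2
  ext i
  simp [Pi.single_apply, eq_comm]

/-- The description of `ℱ` by determinants. -/
theorem forall_le_signVar_iff_detSeq {Z : Matrix (Fin (k + m)) (Fin n) ℝ}
    (hZ : LinearIndependent ℝ (rowVec Z)) (Y : Gr k (k + m)) {y : Fin k → E (k + m)}
    (hy : Submodule.span ℝ (Set.range y) = Y.carrier) :
    (∀ v ∈ (fZInv Z hZ Y).1.carrier, v ≠ 0 → (k : ℤ) ≤ signVar v.ofLp) ↔
      ∀ (I : Finset (Fin n)) (hI : I.card + 1 = m), detSeq Z y I hI ≠ 0 →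
        (k : ℤ) ≤ signVar (detSeq Z y I hI) := by
  have hmemY : ∀ u : Fin (k + m) → ℝ, (∀ a, dotProduct u (y a).ofLp = 0) →
      WithLp.toLp 2 (Matrix.vecMul u Z) ∈ (fZInv Z hZ Y).1.carrier := by
    intro u hu
    refine mem_fZInv_iff.2 ⟨WithLp.toLp 2 u, ?_, ?_⟩
    · rw [← hy, Submodule.mem_orthogonal]
      intro v hv
      induction hv using Submodule.span_induction with
      | mem v hv =>
        obtain ⟨a, rfl⟩ := hv
        rw [real_inner_comm, inner_eq_sum]
        exact hu a
      | zero => simp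
      | add v w _ _ h1 h2 => rw [inner_add_left, h1, h2, add_zero]
      | smul c v _ h1 => rw [inner_smul_left, h1, mul_zero]
    · exact WithLp.ofLp_injective 2 (ofLp_toEuclideanLin_transpose Z _)
  have key := forall_le_signVar_iff (k := k) (fZInv Z hZ Y).1.finrank_eq
    (fun I hI => WithLp.toLp 2 fun j => (detMatrix Z y I hI fun r => Z r j).det) ?_ ?_ ?_
  · rw [key]
    refine forall_congr' fun I => forall_congr' fun hI => ?_
    have : (fun j : {j // j ∉ I} => (WithLp.toLp 2 fun j =>
        (detMatrix Z y I hI fun r => Z r j).det : E n) j) = detSeq Z y I hI :=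
      funext fun j => (detSeq_eq Z y I hI j).symm
    rw [this]
  · intro I hI
    -- The determinant is a linear functional `u` of its last column and vanishes when that column
    -- repeats some `y a`. So `u` lies in Y^⊥, and the sequence is Zᵀu.
    obtain ⟨u, hu⟩ := exists_det_detMatrix_eq Z y I hI
    simp only [hu]
    refine hmemY u fun a => ?_
    rw [← hu]
    subst hI
    refine Matrix.det_zero_of_column_eq (i := Fin.castAdd _ a) (j := Fin.natAdd k (Fin.last _))
      (by simp [Fin.ext_iff]; omega) fun r => ?_
    rw [detMatrix_castAdd, detMatrix_natAdd_last]
  · rintro I rfl i hi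
    obtain ⟨q, hq⟩ : i ∈ Set.range (I.orderEmbOfFin rfl) := by
      rw [Finset.range_orderEmbOfFin]; exact hi
    refine Matrix.det_zero_of_column_eq (i := Fin.natAdd k q.castSucc)
      (j := Fin.natAdd k (Fin.last _)) (by simp [Fin.ext_iff]; omega) fun r => ?_
    rw [detMatrix_natAdd_castSucc, detMatrix_natAdd_last, hq]
  · rintro I hI w hw hw0 huniq h0
    obtain ⟨j, hj⟩ : ∃ i, w i ≠ 0 := by
      by_contra! h0
      exact hw0 (by ext i; exact h0 i)
    have h1 : (detMatrix Z y I hI fun r => Z r j).det = 0 := congrArg (fun x : E n => x j) h0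
    obtain ⟨c, hc0, hc⟩ := Matrix.exists_vecMul_eq_zero_iff.2 h1
    subst hI
    have hcY : ∀ a, dotProduct c (y a).ofLp = 0 := fun a => by
      have := congrFun hc (Fin.castAdd _ a)
      simpa only [Matrix.vecMul, dotProduct, Pi.zero_apply, detMatrix_castAdd] using this
    obtain ⟨t, ht⟩ := huniq _ (hmemY c hcY) fun i hi => by
      obtain ⟨q, hq⟩ : i ∈ Set.range (I.orderEmbOfFin rfl) := by
        rw [Finset.range_orderEmbOfFin]; exact hi
      have := congrFun hc (Fin.natAdd k q.castSucc)
      rw [← hq]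
      simpa only [Matrix.vecMul, dotProduct, Pi.zero_apply, detMatrix_natAdd_castSucc] using this
    have h2 : Matrix.vecMul c Z j = 0 := by
      have := congrFun hc (Fin.natAdd k (Fin.last _))
      simpa only [Matrix.vecMul, dotProduct, Pi.zero_apply, detMatrix_natAdd_last] using this
    have h3 : t * w j = 0 := by rw [← h2]; exact (congrArg (fun x : E n => x j) ht).symm
    have ht0 : t = 0 := (mul_eq_zero.1 h3).resolve_right hj
    rw [ht0, zero_smul] at ht
    exact hc0 (vecMul_injective hZ (by simpa using congrArg WithLp.ofLp ht))

end Criteria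

/-! ### Amplituhedra and closures -/

section Amplituhedra

variable {n k m : ℕ} {Z : Matrix (Fin (k + m)) (Fin n) ℝ}

theorem exists_of_mem_GrNonneg {d : ℕ} {V : Gr d n} (hV : V ∈ GrNonneg d n) :
    ∃ A : Matrix (Fin d) (Fin n) ℝ, rowSpan A = V.carrier ∧ LinearIndependent ℝ (rowVec A) ∧
      ∀ (I : Finset (Fin n)) (hI : I.card = d), 0 ≤ minor A I hI := by
  obtain ⟨A, hA, hpos⟩ := hV
  exact ⟨A, hA, linearIndependent_of_finrank_rowSpan (by rw [hA, V.finrank_eq]), hpos⟩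

/-- A nonzero `x` would have at most `k - 1` and at least `k + m` sign changes. -/
theorem eq_zero_of_mem_GrNonneg_of_mem_orthogonal (hn : k + m ≤ n)
    (hZ : ∀ (I : Finset (Fin n)) (hI : I.card = k + m), 0 < minor Z I hI) {V : Gr k n}
    (hV : V ∈ GrNonneg k n) {x : E n} (hxV : x ∈ V.carrier) (hx : x ∈ (rowSpan Z)ᗮ) : x = 0 := by
  by_contra h
  obtain ⟨A, hA, hli, hpos⟩ := exists_of_mem_GrNonneg hV
  obtain ⟨c, hc⟩ := mem_rowSpan.1 (hA ▸ hxV)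
  have h1 := le_signVar_of_mem_orthogonal hn hZ hx h
  rw [hc] at h1
  refine not_le_signVar_vecMul hpos hli c (le_trans ?_ h1)
  push_cast
  omega

theorem finrank_map_of_mem_GrNonneg (hn : k + m ≤ n)
    (hZ : ∀ (I : Finset (Fin n)) (hI : I.card = k + m), 0 < minor Z I hI) {V : Gr k n}
    (hV : V ∈ GrNonneg k n) : Module.finrank ℝ (V.carrier.map Z.toEuclideanLin) = k := by
  rw [← LinearMap.range_domRestrict, LinearMap.finrank_range_of_inj, V.finrank_eq]
  refine (injective_iff_map_eq_zero _).2 fun x hx => Subtype.ext ?_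
  refine eq_zero_of_mem_GrNonneg_of_mem_orthogonal hn hZ hV x.2 ?_
  rw [← ker_toEuclideanLin]
  exact hx

/-- Adjointness: `u` is orthogonal to Z(V) iff Zᵀu is orthogonal to V. This matches 𝒜 with ℬ and
transfers the dimension count. -/
theorem fZInv_carrier_eq (hli : LinearIndependent ℝ (rowVec Z)) {Y : Gr k (k + m)}
    {V : Submodule ℝ (E n)} (hY : Y.carrier = V.map Z.toEuclideanLin) :
    (fZInv Z hli Y).1.carrier = Vᗮ ⊓ rowSpan Z := by
  have key : ∀ u : E (k + m), u ∈ Y.carrierᗮ ↔ Z.transpose.toEuclideanLin u ∈ Vᗮ := by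
    intro u
    rw [hY, Submodule.mem_orthogonal', Submodule.mem_orthogonal']
    simp [inner_toEuclideanLin_transpose]
  ext x
  rw [mem_fZInv_iff, Submodule.mem_inf, ← range_toEuclideanLin_transpose]
  constructor
  · rintro ⟨u, hu, rfl⟩
    exact ⟨(key u).1 hu, LinearMap.mem_range_self _ u⟩
  · rintro ⟨hx, u, rfl⟩
    exact ⟨u, (key u).2 hx, rfl⟩

theorem finrank_orthogonal_inf_rowSpan (hn : k + m ≤ n)
    (hZ : ∀ (I : Finset (Fin n)) (hI : I.card = k + m), 0 < minor Z I hI) {V : Gr k n}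
    (hV : V ∈ GrNonneg k n) : Module.finrank ℝ ↥(V.carrierᗮ ⊓ rowSpan Z) = m := by
  rw [← fZInv_carrier_eq (linearIndependent_of_minor_pos hn hZ)
    (Y := ⟨_, finrank_map_of_mem_GrNonneg hn hZ hV⟩) rfl]
  exact Gr.finrank_eq _

theorem mem_ampB_iff (hn : k + m ≤ n)
    (hZ : ∀ (I : Finset (Fin n)) (hI : I.card = k + m), 0 < minor Z I hI)
    (X : GrIn m (rowSpan Z)) : X ∈ ampB k m (rowSpan Z) ↔
      fZ Z (linearIndependent_of_minor_pos hn hZ) X ∈ ampA Z := by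
  set hli := linearIndependent_of_minor_pos hn hZ
  constructor
  · rintro ⟨V, hV, hX⟩
    let Y : Gr k (k + m) := ⟨_, finrank_map_of_mem_GrNonneg hn hZ hV⟩
    have h : X = fZInv Z hli Y := Subtype.ext (Gr.ext (hX.trans (fZInv_carrier_eq hli rfl).symm))
    rw [h, fZ_fZInv]
    exact ⟨V, hV, rfl⟩
  · rintro ⟨V, hV, hY⟩
    refine ⟨V, hV, ?_⟩
    rw [← fZInv_carrier_eq hli hY, fZInv_fZ]

theorem ampA_subset_closure (hn : k + m ≤ n)
    (hZ : ∀ (I : Finset (Fin n)) (hI : I.card = k + m), 0 < minor Z I hI) :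
    ampA Z ⊆ closure (fZ Z (linearIndependent_of_minor_pos hn hZ) '' setG k m (rowSpan Z)) := by
  rintro Y ⟨V, hV, hY⟩
  set hZli := linearIndependent_of_minor_pos hn hZ
  obtain ⟨A, hA, hli, hnonneg⟩ := exists_of_mem_GrNonneg hV
  obtain ⟨I₀, hI₀, h₀⟩ := exists_minor_ne_zero hli
  obtain ⟨G, hG, hG0, hpos⟩ := exists_perturbation_minor_pos hnonneg h₀
  have hkn : k ≤ n := by omega
  have hcases : ∀ t : NNReal, t = 0 ∨ 0 < (t : ℝ) := fun t => by
    rcases eq_or_ne t 0 with h | h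
    · exact Or.inl h
    · exact Or.inr (NNReal.coe_pos.2 (pos_iff_ne_zero.2 h))
  have hzero : A * G ((0 : NNReal) : ℝ) = A := by rw [NNReal.coe_zero, hG0, Matrix.mul_one]
  have hAli : ∀ t : NNReal, LinearIndependent ℝ (rowVec (A * G t)) := fun t => by
    rcases hcases t with rfl | h
    · rw [hzero]; exact hli
    · exact linearIndependent_of_minor_pos hkn (hpos t h)
  have hmem : ∀ t : NNReal, (⟨rowSpan (A * G t), finrank_rowSpan (hAli t)⟩ : Gr k n) ∈
      GrNonneg k n := fun t => by
    refine ⟨A * G t, rfl, fun I hI => ?_⟩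
    rcases hcases t with rfl | h
    · rw [hzero]; exact hnonneg I hI
    · exact (hpos t h I hI).le
  -- The parameter is restricted to `t ≥ 0`, where the perturbed matrix is known to have full rank
  -- and nonnegative minors, so that `F` is defined everywhere.
  let F : NNReal → Gr k (k + m) := fun t => ⟨_, finrank_map_of_mem_GrNonneg hn hZ (hmem t)⟩
  let b : NNReal → Fin k → E (k + m) := fun t i => Z.toEuclideanLin (rowVec (A * G t) i)
  have hb : Continuous b := by
    refine continuous_pi fun i => (LinearMap.continuous_of_finiteDimensional _).comp ?_
    refine (PiLp.continuous_toLp 2 _).comp ?_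
    have : Continuous fun t : NNReal => A * G t :=
      continuous_const.matrix_mul (hG.comp NNReal.continuous_coe)
    exact (continuous_apply i).comp this
  have hspan : Submodule.span ℝ (Set.range (b 0)) = (F 0).carrier := by
    have : b 0 = Z.toEuclideanLin ∘ rowVec (A * G ((0 : NNReal) : ℝ)) := rfl
    rw [this, Set.range_comp, ← Submodule.map_span]
    rfl
  have hb0 : LinearIndependent ℝ (b 0) := by
    rw [linearIndependent_iff_card_eq_finrank_span, Fintype.card_fin, Set.finrank, hspan]
    exact (F 0).finrank_eq.symm
  have hF : ContinuousAt F 0 := Gr.continuousAt_of_section b hb.continuousAt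
    (fun t i => Submodule.mem_map_of_mem (Submodule.subset_span ⟨i, rfl⟩)) hb0
  have hF0 : F 0 = Y := by
    refine Gr.ext ?_
    rw [hY, ← hA]
    change (rowSpan (A * G ((0 : NNReal) : ℝ))).map _ = _
    rw [hzero]
  rw [ContinuousAt, hF0] at hF
  refine mem_closure_of_tendsto (hF.mono_left (nhdsWithin_le_nhds (s := Set.Ioi 0))) ?_
  filter_upwards [self_mem_nhdsWithin] with t ht
  refine ⟨fZInv Z hZli (F t), fun v hv hv0 => ?_, fZ_fZInv hZli _⟩
  rw [fZInv_carrier_eq hZli rfl] at hv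
  exact le_signVar_of_mem_orthogonal hkn (hpos t (NNReal.coe_pos.2 ht)) hv.1 hv0

theorem ampB_subset_closure (hn : k + m ≤ n)
    (hZ : ∀ (I : Finset (Fin n)) (hI : I.card = k + m), 0 < minor Z I hI) :
    ampB k m (rowSpan Z) ⊆ closure (setG k m (rowSpan Z)) := by
  intro X hX
  have h := ampA_subset_closure hn hZ ((mem_ampB_iff hn hZ X).1 hX)
  have h1 := (fZHomeomorph (linearIndependent_of_minor_pos hn hZ)).image_closure
    (setG k m (rowSpan Z))
  have h2 : fZHomeomorph (linearIndependent_of_minor_pos hn hZ) X ∈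
      fZHomeomorph (linearIndependent_of_minor_pos hn hZ) '' closure (setG k m (rowSpan Z)) := by
    rw [h1]; exact h
  exact (Homeomorph.injective _).mem_set_image.1 h2

theorem closure_setG_subset (hn : k + m ≤ n)
    (hZ : ∀ (I : Finset (Fin n)) (hI : I.card = k + m), 0 < minor Z I hI)
    (hext : ExtensionProperty m (n - k) n) :
    closure (setG k m (rowSpan Z)) ⊆ ampB k m (rowSpan Z) := by
  intro X hX
  have hkn : k ≤ n := by omega
  -- The bound var(v) ≥ k defining 𝒢 is open, not closed; what passes to limits is its consequence
  -- for the alternated vectors.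
  have hvar : ∀ v ∈ X.1.carrier, ¬ ((n - k : ℕ) : ℤ) ≤ signVar (altSeq v.ofLp) := by
    refine closure_minimal (t := Subtype.val ⁻¹' {X : Gr m n | ∀ v ∈ X.carrier,
      ¬ ((n - k : ℕ) : ℤ) ≤ signVar (altSeq v.ofLp)}) (fun X' hX' v hv => ?_)
      ((isClosed_setOf_forall_signVar_altSeq (n - k)).preimage continuous_subtype_val) hX
    exact signVar_lt_iff.1 (signVar_altSeq_le hkn fun h0 =>
      hX' v hv fun h => h0 (congrArg WithLp.ofLp h))
  obtain ⟨V', hV', hle⟩ := hext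
    ⟨X.1.carrier.map (altE n).toLinearMap, (LinearEquiv.finrank_map_eq (altE n) _).trans
      X.1.finrank_eq⟩ (by
    rintro _ ⟨v, hv, rfl⟩
    exact signVar_lt_iff.2 (hvar v hv))
  obtain ⟨A, hA, hli, hpos⟩ := exists_of_mem_GrNonneg hV'
  -- The subspace sought is alt(V'^⊥). As alt is self-adjoint, alt X ⊆ V' says that X is orthogonal
  -- to it, and both sides have dimension `m`.
  obtain ⟨C, hCli, hC, c, hc, hmin⟩ := exists_dual (k := k) (by omega) hli hpos
  have hV : (⟨rowSpan C, finrank_rowSpan hCli⟩ : Gr k n) ∈ GrNonneg k n := by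
    refine ⟨C, rfl, fun J hJ => ?_⟩
    have hJc : Jᶜ.card = n - k := by rw [Finset.card_compl, Fintype.card_fin, hJ]
    have h1 := hmin Jᶜ hJc
    rw [minor_congr C (compl_compl J)] at h1
    rw [h1]
    exact mul_nonneg hc.le (hpos _ _)
  refine ⟨_, hV, Submodule.eq_of_le_of_finrank_eq (le_inf ?_ X.2)
    (X.1.finrank_eq.trans (finrank_orthogonal_inf_rowSpan hn hZ hV).symm)⟩
  intro x hx u hu
  change u ∈ rowSpan C at hu
  rw [hC] at hu
  obtain ⟨u', hu', rfl⟩ := hu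
  have h1 : altE n x ∈ rowSpan A := hA ▸ hle (Submodule.mem_map_of_mem hx)
  change inner ℝ (altE n u') x = 0
  rw [inner_altE, real_inner_comm]
  exact hu' _ h1

end Amplituhedra

end

end Amplituhedron

theorem mainTheorem11 (n k m : ℕ) (hn : k + m ≤ n) (Z : Matrix (Fin (k + m)) (Fin n) ℝ)
    (hZ : ∀ (I : Finset (Fin n)) (hI : I.card = k + m), 0 < minor Z I hI) :
    -- `dim (V^⊥ ∩ W) = m` and `dim Z(V) = k` for all `V ∈ Gr_{k,n}^{≥ 0}`
    (∀ V ∈ GrNonneg k n,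
      Module.finrank ℝ ↥(V.carrierᗮ ⊓ rowSpan Z) = m ∧
      Module.finrank ℝ ↥(V.carrier.map Z.toEuclideanLin) = k) ∧
    -- `𝒢` is open, its closure contains `ℬ`, and equals `ℬ` given the extension property
    IsOpen (setG k m (rowSpan Z)) ∧
    ampB k m (rowSpan Z) ⊆ closure (setG k m (rowSpan Z)) ∧
    (ExtensionProperty m (n - k) n →
      ampB k m (rowSpan Z) = closure (setG k m (rowSpan Z))) ∧
    -- the description of `𝒢` by Plücker coordinates, for any representing matrix `A` of `X`
    (∀ (X : GrIn m (rowSpan Z)) (A : Matrix (Fin m) (Fin n) ℝ), rowSpan A = X.1.carrier →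
      (X ∈ setG k m (rowSpan Z) ↔
        ∀ (I : Finset (Fin n)) (hI : I.card + 1 = m), pluckerSeq A I hI ≠ 0 →
          (k : ℤ) ≤ signVar (pluckerSeq A I hI))) ∧
    -- the description of `ℱ = f_Z(𝒢)`, for any basis `y` of `Y`
    (∀ (Y : Gr k (k + m)) (y : Fin k → E (k + m)),
      Submodule.span ℝ (Set.range y) = Y.carrier →
      (Y ∈ fZ Z (linearIndependent_of_minor_pos hn hZ) '' setG k m (rowSpan Z) ↔
        ∀ (I : Finset (Fin n)) (hI : I.card + 1 = m), detSeq Z y I hI ≠ 0 →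
          (k : ℤ) ≤ signVar (detSeq Z y I hI))) ∧
    -- the closure of `ℱ` contains `𝒜`, and equals `𝒜` given the extension property
    ampA Z ⊆ closure (fZ Z (linearIndependent_of_minor_pos hn hZ) '' setG k m (rowSpan Z)) ∧
    (ExtensionProperty m (n - k) n →
      ampA Z = closure (fZ Z (linearIndependent_of_minor_pos hn hZ) '' setG k m (rowSpan Z))) := by
  have hli : LinearIndependent ℝ (rowVec Z) := linearIndependent_of_minor_pos hn hZ
  refine ⟨fun V hV => ⟨finrank_orthogonal_inf_rowSpan hn hZ hV, finrank_map_of_mem_GrNonneg hn hZ hV⟩,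
    (isOpen_setOf_forall_le_signVar k).preimage continuous_subtype_val,
    ampB_subset_closure hn hZ,
    fun hext => (ampB_subset_closure hn hZ).antisymm (closure_setG_subset hn hZ hext),
    fun X A hA => forall_le_signVar_iff_pluckerSeq X.1.finrank_eq hA,
    fun Y y hy => ?_,
    ampA_subset_closure hn hZ,
    fun hext => (ampA_subset_closure hn hZ).antisymm ?_⟩
  · rw [← forall_le_signVar_iff_detSeq hli Y hy]
    constructor
    · rintro ⟨X, hX, rfl⟩
      rw [fZInv_fZ]
      exact hX
    · exact fun h => ⟨fZInv Z hli Y, h, fZ_fZInv hli Y⟩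
  · have h := (fZHomeomorph hli).image_closure (setG k m (rowSpan Z))
    rintro Y hY
    have hY' : Y ∈ fZHomeomorph hli '' closure (setG k m (rowSpan Z)) := by rw [h]; exact hY
    obtain ⟨X, hX, rfl⟩ := hY'
    exact (mem_ampB_iff hn hZ X).1 (closure_setG_subset hn hZ hext hX)
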